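/- **Theorem (Inverse riffle shuffle with concentrated pile-size law).** For each $n\ge 1$ let $f_n$ be a probability distribution on $[n]=\{1,\dots,n\}$. Consider the Markov chain on the $n!$ orderings of a deck of $n$ cards in which each step independently chooses $K_n\in[n]$ with law $f_n$, then chooses a uniformly random set of $K_n$ cards, and moves these cards to the top of the deck, preserving the relative order of the chosen cards and of the remaining cards. Let $P_n$ be its transition matrix, let $\pi_n$ be a stationary distribution of $P_n$ (for all large $n$ it is unique and uniform under the assumptions below), and let $$s_n(t)=\max_{x}\max_{y}\Bigl\{1-\frac{P_n^t(x,y)}{\pi_n(y)}\Bigr\}$$ be the separation distance. Put $Y_n=K_n/n$, and assume that $Y_n\to\alpha$ in probability for some $\alpha\in(0,1)$ and that $\operatorname{Var}(Y_n)=o(1/\log n)$. Define $$q_{2,n}=\sum_{k=1}^n f_n(k)\,\frac{\binom{k}{2}+\binom{n-k}{2}}{\binom n2}.$$ Let $c\in\mathbb R$. If $(t_n)$ is any sequence of non-negative integers such that, for all sufficiently large $n$, $$t_n=\frac{2\log n+c+o(1)}{-\log q_{2,n}},$$ then $$\lim_{n\to\infty}s_n(t_n)=1-\exp\left(-\tfrac12e^{-c}\right).$$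 -/

import Mathlib

open Filter Topology Asymptotics

noncomputable section

namespace MarkovChain

variable {X : Type*} [Fintype X] [DecidableEq X]

/-- `π` is a stationary probability distribution of the transition matrix `P`. -/
def IsStationary (P : Matrix X X ℝ) (π : X → ℝ) : Prop :=
  (∀ x, 0 ≤ π x) ∧ ∑ x, π x = 1 ∧ ∀ y, ∑ x, π x * P x y = π y

/-- The separation distance `s(t) = max_x max_y (1 - P^t(x,y) / π(y))`
(on a finite nonempty type the suprema are maxima). -/
def separation (P : Matrix X X ℝ) (π : X → ℝ) (t : ℕ) : ℝ :=
  ⨆ x : X, ⨆ y : X, (1 - (P ^ t) x y / π y)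

end MarkovChain

namespace InverseRiffle

/-- `f` is a probability distribution on `[n] = {1, …, n}` (values of `f` outside `[n]` are
never used). -/
def IsLaw (n : ℕ) (f : ℕ → ℝ) : Prop :=
  (∀ k ∈ Finset.Icc 1 n, 0 ≤ f k) ∧ ∑ k ∈ Finset.Icc 1 n, f k = 1

/-- A deck of `n` cards is a permutation `σ`, where `σ p` is the card in position `p` and position
`0` is the top. `moveToTop A σ` is the deck obtained by moving the cards in `A` to the top,
preserving the relative order of the cards of `A` and of the remaining cards (`Tuple.sort` is the
stable sort of the positions); see `moveToTop_lt_iff`. -/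
def moveToTop {n : ℕ} (A : Finset (Fin n)) (σ : Equiv.Perm (Fin n)) : Equiv.Perm (Fin n) :=
  (Tuple.sort fun p : Fin n => if σ p ∈ A then (0 : ℕ) else 1).trans σ

/-- After the move, card `c` lies above card `d` iff `c` was selected and `d` was not, or both or
neither were selected and `c` was above `d` before. -/
theorem moveToTop_lt_iff {n : ℕ} (A : Finset (Fin n)) (σ : Equiv.Perm (Fin n)) (c d : Fin n) :
    (moveToTop A σ).symm c < (moveToTop A σ).symm d ↔
      (c ∈ A ∧ d ∉ A) ∨ ((c ∈ A ↔ d ∈ A) ∧ σ.symm c < σ.symm d) := by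
  set g : Fin n → ℕ := fun p : Fin n => if σ p ∈ A then (0 : ℕ) else 1
  obtain ⟨hm, hs⟩ := (Tuple.eq_sort_iff (f := g) (σ := Tuple.sort g)).1 rfl
  obtain ⟨i, rfl⟩ := (moveToTop A σ).surjective c
  obtain ⟨j, rfl⟩ := (moveToTop A σ).surjective d
  have hi : ∀ i, moveToTop A σ i = σ (Tuple.sort g i) := fun i => rfl
  simp only [Equiv.symm_apply_apply]
  simp only [hi, Equiv.symm_apply_apply]
  have key : ∀ i j, i < j → (g (Tuple.sort g i) < g (Tuple.sort g j)) ∨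
      (g (Tuple.sort g i) = g (Tuple.sort g j) ∧ Tuple.sort g i < Tuple.sort g j) := by
    intro i j hij
    rcases (hm hij.le).lt_or_eq with h | h
    · exact Or.inl h
    · exact Or.inr ⟨h, hs i j hij h⟩
  have conv : (σ (Tuple.sort g i) ∈ A ∧ σ (Tuple.sort g j) ∉ A ∨
      ((σ (Tuple.sort g i) ∈ A ↔ σ (Tuple.sort g j) ∈ A) ∧ Tuple.sort g i < Tuple.sort g j)) ↔
      (g (Tuple.sort g i) < g (Tuple.sort g j)) ∨
      (g (Tuple.sort g i) = g (Tuple.sort g j) ∧ Tuple.sort g i < Tuple.sort g j) := by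
    have hgv : ∀ p, g p = if σ p ∈ A then 0 else 1 := fun _ => rfl
    rw [hgv, hgv]
    by_cases h1 : σ (Tuple.sort g i) ∈ A <;> by_cases h2 : σ (Tuple.sort g j) ∈ A <;>
      simp only [h1, h2] <;> simp
  rw [conv]
  refine ⟨key i j, fun h => ?_⟩
  rcases lt_trichotomy i j with hij | hij | hij
  · exact hij
  · subst hij; simp at h
  · rcases key j i hij with h' | h' <;> rcases h with h | h <;> omega

/-- One step of the shuffle: choose `k ∈ [n]` with probability `f k`, then choose a uniformly random
set `A` of `k` cards, and move the cards of `A` to the top. -/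
def transition (n : ℕ) (f : ℕ → ℝ) :
    Matrix (Equiv.Perm (Fin n)) (Equiv.Perm (Fin n)) ℝ :=
  Matrix.of fun σ τ => ∑ k ∈ Finset.Icc 1 n, f k *
    ∑ A ∈ Finset.powersetCard k (Finset.univ : Finset (Fin n)),
      (1 / (n.choose k : ℝ)) * (if moveToTop A σ = τ then 1 else 0)

/-- The uniform distribution is stationary for the shuffle. -/
theorem uniform_isStationary (n : ℕ) (f : ℕ → ℝ) (hf : IsLaw n f) :
    MarkovChain.IsStationary (transition n f) (fun _ => 1 / (n.factorial : ℝ)) := by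
  have hn : (n.factorial : ℝ) ≠ 0 := by positivity
  -- relabelling the cards commutes with the shuffle
  have hmove : ∀ (A : Finset (Fin n)) (σ g : Equiv.Perm (Fin n)),
      moveToTop (A.map g.toEmbedding) (σ.trans g) = (moveToTop A σ).trans g := by
    intro A σ g
    simp [moveToTop, Equiv.trans_assoc]
  have hinv : ∀ σ τ g : Equiv.Perm (Fin n),
      transition n f (σ.trans g) (τ.trans g) = transition n f σ τ := by
    intro σ τ g
    simp only [transition, Matrix.of_apply]
    refine Finset.sum_congr rfl fun k _ => ?_
    congr 1
    symm
    refine Finset.sum_bij (fun A _ => A.map g.toEmbedding) ?_ ?_ ?_ ?_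
    · intro A hA
      simpa [Finset.mem_powersetCard] using hA
    · intro A _ B _ h
      exact Finset.map_injective _ h
    · intro B hB
      refine ⟨B.map g.symm.toEmbedding, ?_, ?_⟩
      · simpa [Finset.mem_powersetCard] using hB
      · ext x; simp
    · intro A _
      rw [hmove]
      have : ((moveToTop A σ).trans g = τ.trans g) ↔ (moveToTop A σ = τ) := by
        constructor
        · intro h
          ext x
          have := congrArg (fun e : Equiv.Perm (Fin n) => e x) h
          exact congrArg Fin.val (g.injective this)
        · rintro rfl; rfl
      simp only [this]
  have hrow : ∀ σ, ∑ τ, transition n f σ τ = 1 := by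
    intro σ
    simp only [transition, Matrix.of_apply]
    rw [Finset.sum_comm]
    refine Eq.trans ?_ hf.2
    refine Finset.sum_congr rfl fun k hk => ?_
    rw [← Finset.mul_sum, Finset.sum_comm]
    have hk' : (n.choose k : ℝ) ≠ 0 := by
      have := Nat.choose_pos (Finset.mem_Icc.1 hk).2
      positivity
    simp [hk']
  refine ⟨fun _ => by positivity, ?_, fun τ => ?_⟩
  · simp [Fintype.card_perm, hn]
  · rw [← Finset.mul_sum]
    have : ∑ σ, transition n f σ τ = ∑ σ, transition n f τ σ := by
      refine Fintype.sum_bijective (fun σ : Equiv.Perm (Fin n) => (τ * σ⁻¹ * τ : Equiv.Perm (Fin n)))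
        ?_ _ _ ?_
      · exact ((Group.mulRight_bijective τ).comp (Group.mulLeft_bijective τ)).comp
          (inv_involutive.bijective)
      · intro σ
        have h := hinv σ τ (τ * σ⁻¹)
        rw [← h]
        congr 1
        ext x; simp
    rw [this, hrow, mul_one]

/-- `ℙ[|K / n - a| ≥ ε]` for `K` with law `f`. -/
def deviationProb (n : ℕ) (f : ℕ → ℝ) (a ε : ℝ) : ℝ :=
  ∑ k ∈ (Finset.Icc 1 n).filter (fun k : ℕ => ε ≤ |(k : ℝ) / n - a|), f k

/-- `𝔼[K / n]` for `K` with law `f`. -/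
def pileMean (n : ℕ) (f : ℕ → ℝ) : ℝ :=
  ∑ k ∈ Finset.Icc 1 n, f k * ((k : ℝ) / n)

/-- `Var(K / n)` for `K` with law `f`. -/
def pileVariance (n : ℕ) (f : ℕ → ℝ) : ℝ :=
  ∑ k ∈ Finset.Icc 1 n, f k * ((k : ℝ) / n - pileMean n f) ^ 2

/-- `q₂ = ∑ₖ f(k) (C(k,2) + C(n-k,2)) / C(n,2)`. -/
def qTwo (n : ℕ) (f : ℕ → ℝ) : ℝ :=
  ∑ k ∈ Finset.Icc 1 n,
    f k * (((k.choose 2 : ℝ) + ((n - k).choose 2 : ℝ)) / (n.choose 2 : ℝ))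

end InverseRiffle

end

/-! ### The law of the sets selected in the first `t` steps -/

namespace InverseRiffle

/-! Call two cards tied if they are selected at exactly the same steps. Tied cards keep their
initial order; the order of untied cards is fixed by the last step separating them, whatever the
initial deck. If no two cards are tied (`Distinguished`), the final deck is therefore independent of
the start and, by symmetry under relabelling, uniform. Hence every entry of `P^t` is at least
`ℙ(Distinguished) / n!`, and the reversed deck attains this bound because a tied pair cannot be
reversed. So the separation distance is exactly `1 - ℙ(Distinguished)` (`separation_transition`), as
soon as this probability is positive, which also forces the stationary law to be uniform.

It remains to see that ties disappear with probability tending to `exp(-e^{-c}/2)`. Let `W` be the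
number of two-element tie classes. For a fixed pattern of blocks on `v` distinct cards, the
probability of being tied within blocks for `t` steps is `p^t`, where `p` (`tieProb`) is, up to
`O(1/n)`, the mean over `Y = K/n` of the probability that i.i.d. Bernoulli(`Y`) variables are
constant on blocks.

For `r` disjoint pairs, `p = q₂^r + O(1/n + Var Y)`: the linear terms vanish at the mean. As `t` is
of order `log n`, the variance hypothesis makes the error harmless, and `n^{2r} p^t → e^{-cr}`. For
blocks of size at least two, one of size at least three, the limit `P` of `p` satisfies `P² < G^v`
with `G = lim q₂` (`sq_blockPoly_lt`). Since `n² q₂^t` stays bounded, `n^v p^t → 0`.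

Consequently `𝔼[C(W, r)] → (e^{-c}/2)^r / r!` (`tendsto_isolatedMoment`), and the Bonferroni
inequalities give `ℙ(W = 0) → exp(-e^{-c}/2)`. If `W = 0` but some cards are tied, three cards are
tied together, which has vanishing probability. -/

/-- The one-step probability that the set of selected cards is `A`. -/
noncomputable def weight (n : ℕ) (f : ℕ → ℝ) (A : Finset (Fin n)) : ℝ :=
  -- `IsLaw` does not constrain `f 0`, so the empty set has to be given weight zero by hand.
  if A.card = 0 then 0 else f A.card / n.choose A.card

theorem sum_weight_mul (n : ℕ) (f : ℕ → ℝ) (φ : Finset (Fin n) → ℝ) :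
    ∑ A, weight n f A * φ A = ∑ k ∈ Finset.Icc 1 n, f k *
      ∑ A ∈ Finset.powersetCard k (Finset.univ : Finset (Fin n)), (1 / (n.choose k : ℝ)) * φ A := by
  have h := Finset.sum_powerset (Finset.univ : Finset (Fin n)) (fun A => weight n f A * φ A)
  rw [Finset.powerset_univ] at h
  rw [h, Finset.card_univ, Fintype.card_fin, Finset.range_eq_Ico,
    Finset.sum_eq_sum_Ico_succ_bot (Nat.succ_pos n)]
  have h0 : ∑ A ∈ Finset.powersetCard 0 (Finset.univ : Finset (Fin n)), weight n f A * φ A = 0 := by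
    simp [weight]
  rw [h0, zero_add]
  refine Finset.sum_congr (by ext; simp only [Finset.mem_Ico, Finset.mem_Icc]; omega) fun k hk => ?_
  rw [Finset.mul_sum]
  refine Finset.sum_congr rfl fun A hA => ?_
  have hc := (Finset.mem_powersetCard.1 hA).2
  have hk' : k ≠ 0 := by have := (Finset.mem_Icc.1 hk).1; omega
  rw [weight, hc, if_neg hk']
  ring

theorem sum_weight_mul_card (n : ℕ) (f : ℕ → ℝ) (φ : ℕ → ℝ) :
    ∑ A : Finset (Fin n), weight n f A * φ A.card = ∑ k ∈ Finset.Icc 1 n, f k * φ k := by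
  rw [sum_weight_mul n f (fun A => φ A.card)]
  refine Finset.sum_congr rfl fun k hk => ?_
  have hk' : (n.choose k : ℝ) ≠ 0 := by
    have := Nat.choose_pos (Finset.mem_Icc.1 hk).2
    positivity
  rw [Finset.sum_congr rfl fun A hA => by rw [(Finset.mem_powersetCard.1 hA).2]]
  simp [hk']

theorem weight_nonneg {n : ℕ} {f : ℕ → ℝ} (hf : IsLaw n f) (A : Finset (Fin n)) :
    0 ≤ weight n f A := by
  unfold weight
  split_ifs with h
  · exact le_rfl
  · have hA : A.card ≤ n := by simpa using A.card_le_univ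
    exact div_nonneg (hf.1 _ (Finset.mem_Icc.2 ⟨by omega, hA⟩)) (by positivity)

theorem sum_weight {n : ℕ} {f : ℕ → ℝ} (hf : IsLaw n f) : ∑ A, weight n f A = 1 := by
  have := sum_weight_mul_card n f (fun _ => 1)
  simpa [hf.2] using this

theorem weight_map {n : ℕ} (f : ℕ → ℝ) (g : Equiv.Perm (Fin n)) (A : Finset (Fin n)) :
    weight n f (A.map g.toEmbedding) = weight n f A := by
  simp [weight]

/-- The probability of an event depending on the sets of cards selected in the first `t` steps. -/
noncomputable def pathProb (n : ℕ) (f : ℕ → ℝ) (t : ℕ) (E : (Fin t → Finset (Fin n)) → Prop) : ℝ :=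
  open Classical in ∑ A, if E A then ∏ s, weight n f (A s) else 0

section pathProb

variable {n : ℕ} {f : ℕ → ℝ} {t : ℕ}

theorem pathProb_eq_sum (E : (Fin t → Finset (Fin n)) → Prop) [DecidablePred E] :
    pathProb n f t E = ∑ A, if E A then ∏ s, weight n f (A s) else 0 := by
  unfold pathProb
  congr!

theorem pathWeight_nonneg (hf : IsLaw n f) (A : Fin t → Finset (Fin n)) :
    0 ≤ ∏ s, weight n f (A s) :=
  Finset.prod_nonneg fun _ _ => weight_nonneg hf _

theorem pathProb_nonneg (hf : IsLaw n f) (E : (Fin t → Finset (Fin n)) → Prop) :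
    0 ≤ pathProb n f t E :=
  Finset.sum_nonneg fun A _ => by split_ifs; exacts [pathWeight_nonneg hf A, le_rfl]

theorem pathProb_mono (hf : IsLaw n f) {E F : (Fin t → Finset (Fin n)) → Prop}
    (h : ∀ A, E A → F A) : pathProb n f t E ≤ pathProb n f t F := by
  classical
  refine Finset.sum_le_sum fun A _ => ?_
  by_cases hE : E A
  · simp [hE, h A hE]
  · rw [if_neg hE]
    split_ifs; exacts [pathWeight_nonneg hf A, le_rfl]

theorem pathProb_congr {E F : (Fin t → Finset (Fin n)) → Prop}
    (h : ∀ A, E A ↔ F A) : pathProb n f t E = pathProb n f t F := by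
  rw [funext fun A => propext (h A)]

theorem pathProb_union_le (hf : IsLaw n f) {ι : Type*} (s : Finset ι)
    {E : (Fin t → Finset (Fin n)) → Prop} {F : ι → (Fin t → Finset (Fin n)) → Prop}
    (h : ∀ A, E A → ∃ i ∈ s, F i A) : pathProb n f t E ≤ ∑ i ∈ s, pathProb n f t (F i) := by
  classical
  unfold pathProb
  rw [Finset.sum_comm]
  refine Finset.sum_le_sum fun A _ => ?_
  have hnn : ∀ i ∈ s, (0 : ℝ) ≤ if F i A then ∏ s, weight n f (A s) else 0 := fun i _ => by
    split_ifs; exacts [pathWeight_nonneg hf A, le_rfl]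
  by_cases hE : E A
  · obtain ⟨i, hi, hF⟩ := h A hE
    have := Finset.single_le_sum hnn hi
    simpa [hE, hF] using this
  · rw [if_neg hE]
    exact Finset.sum_nonneg hnn

theorem pathProb_add_compl (E F : (Fin t → Finset (Fin n)) → Prop) :
    pathProb n f t (fun A => E A ∧ F A) + pathProb n f t (fun A => E A ∧ ¬ F A) =
      pathProb n f t E := by
  classical
  unfold pathProb
  rw [← Finset.sum_add_distrib]
  refine Finset.sum_congr rfl fun A _ => ?_
  by_cases hE : E A <;> by_cases hF : F A <;> simp [hE, hF]

/-- The steps are independent, so a condition imposed on each step separately contributes a `t`-th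
power. -/
theorem pathProb_forall (E : Finset (Fin n) → Prop) [DecidablePred E] :
    pathProb n f t (fun A => ∀ s, E (A s)) = (∑ A, if E A then weight n f A else 0) ^ t := by
  simp only [Fintype.sum_pow, Fintype.prod_ite_zero]
  exact @pathProb_eq_sum _ _ _ _ fun _ => Fintype.decidableForallFintype

theorem pathProb_map (g : Equiv.Perm (Fin n)) (E : (Fin t → Finset (Fin n)) → Prop) :
    pathProb n f t (fun A => E fun s => (A s).map g.toEmbedding) = pathProb n f t E := by
  classical
  rw [pathProb_eq_sum, pathProb_eq_sum]
  refine Fintype.sum_equiv (Equiv.piCongrRight fun _ : Fin t => g.finsetCongr) _ _ fun A => ?_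
  simp only [Equiv.piCongrRight_apply, Pi.map_apply, Equiv.finsetCongr_apply, weight_map]
  rfl

end pathProb

/-! ### Ties between cards and the final deck -/

/-- Cards `c` and `d` are selected at the same steps. -/
def Tied {n t : ℕ} (A : Fin t → Finset (Fin n)) (c d : Fin n) : Prop := ∀ s, c ∈ A s ↔ d ∈ A s

theorem Tied.refl {n t : ℕ} (A : Fin t → Finset (Fin n)) (c : Fin n) : Tied A c c :=
  fun _ => Iff.rfl

theorem Tied.symm {n t : ℕ} {A : Fin t → Finset (Fin n)} {c d : Fin n} (h : Tied A c d) :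
    Tied A d c := fun s => (h s).symm

theorem Tied.trans {n t : ℕ} {A : Fin t → Finset (Fin n)} {c d e : Fin n} (h : Tied A c d)
    (h' : Tied A d e) : Tied A c e := fun s => (h s).trans (h' s)

/-- The deck after moving the cards of `A 0`, …, `A (t - 1)` to the top successively. -/
def finalDeck {n : ℕ} : (t : ℕ) → (Fin t → Finset (Fin n)) → Equiv.Perm (Fin n) →
    Equiv.Perm (Fin n)
  | 0, _, σ => σ
  | t + 1, A, σ => moveToTop (A (Fin.last t)) (finalDeck t (Fin.init A) σ)

theorem transition_apply (n : ℕ) (f : ℕ → ℝ) (σ τ : Equiv.Perm (Fin n)) :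
    transition n f σ τ = ∑ A, weight n f A * if moveToTop A σ = τ then 1 else 0 := by
  rw [sum_weight_mul]
  rfl

theorem transition_pow_apply (n : ℕ) (f : ℕ → ℝ) (t : ℕ) (σ τ : Equiv.Perm (Fin n)) :
    (transition n f ^ t) σ τ = pathProb n f t fun A => finalDeck t A σ = τ := by
  classical
  induction t generalizing τ with
  | zero =>
    simp only [pathProb, finalDeck, pow_zero, Matrix.one_apply]
    simp
  | succ t ih =>
    rw [pow_succ, Matrix.mul_apply]
    simp only [ih, transition_apply, pathProb_eq_sum]
    rw [← (Fin.snocEquiv fun _ => Finset (Fin n)).sum_comp, Fintype.sum_prod_type]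
    simp only [Finset.sum_mul_sum]
    rw [Finset.sum_comm]
    conv_lhs => enter [2, A']; rw [Finset.sum_comm]
    rw [Finset.sum_comm]
    refine Finset.sum_congr rfl fun B _ => Finset.sum_congr rfl fun A _ => ?_
    have h : finalDeck (t + 1) (Fin.snoc A B : Fin (t + 1) → Finset (Fin n)) σ =
        moveToTop B (finalDeck t A σ) := by
      simp [finalDeck]
    have h' : (Fin.snocEquiv fun _ => Finset (Fin n)) (B, A) = Fin.snoc A B := rfl
    simp only [h', h, Fin.prod_univ_castSucc, Fin.snoc_castSucc, Fin.snoc_last]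
    rw [Finset.sum_eq_single (finalDeck t A σ)]
    · simp
    · intro b _ hb
      simp [hb.symm]
    · simp

theorem finalDeck_symm_lt_iff_of_tied {n t : ℕ} (A : Fin t → Finset (Fin n))
    (σ : Equiv.Perm (Fin n)) {c d : Fin n} (h : Tied A c d) :
    (finalDeck t A σ).symm c < (finalDeck t A σ).symm d ↔ σ.symm c < σ.symm d := by
  induction t with
  | zero => rfl
  | succ t ih =>
    rw [finalDeck, moveToTop_lt_iff, ih (Fin.init A) fun s => h s.castSucc]
    have := h (Fin.last t)
    tauto

/-- The last step selecting just one of the two cards decides their order, and later steps preserve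
it; the initial deck plays no role. -/
theorem finalDeck_symm_lt_iff_of_not_tied {n t : ℕ} (A : Fin t → Finset (Fin n))
    (σ σ' : Equiv.Perm (Fin n)) {c d : Fin n} (h : ¬ Tied A c d) :
    (finalDeck t A σ).symm c < (finalDeck t A σ).symm d ↔
      (finalDeck t A σ').symm c < (finalDeck t A σ').symm d := by
  induction t with
  | zero => exact absurd (fun s => s.elim0) h
  | succ t ih =>
    rw [finalDeck, finalDeck, moveToTop_lt_iff, moveToTop_lt_iff]
    by_cases hl : c ∈ A (Fin.last t) ↔ d ∈ A (Fin.last t)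
    · have : ¬ Tied (Fin.init A) c d := by
        intro h'
        refine h fun s => ?_
        induction s using Fin.lastCases with
        | last => exact hl
        | cast s => exact h' s
      rw [ih _ this]
    · tauto

/-- The only order automorphism of `Fin n` is the identity. -/
theorem perm_eq_of_symm_lt_iff {n : ℕ} {σ τ : Equiv.Perm (Fin n)}
    (h : ∀ c d, σ.symm c < σ.symm d ↔ τ.symm c < τ.symm d) : σ = τ := by
  have hm : StrictMono (σ.trans τ.symm) := by
    intro i j hij
    have := (h (σ i) (σ j)).1 (by simpa using hij)
    simpa using this
  let e : Fin n ≃o Fin n := hm.orderIsoOfSurjective _ (σ.trans τ.symm).surjective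
  have he : e = OrderIso.refl _ := Subsingleton.elim _ _
  ext i
  have : (σ.trans τ.symm) i = i := congrArg (fun e : Fin n ≃o Fin n => e i) he
  have h2 := congrArg τ this
  simp at h2
  rw [h2]

/-- All cards are distinguished by the steps at which they are selected. -/
def Distinguished {n t : ℕ} (A : Fin t → Finset (Fin n)) : Prop := ∀ c d, Tied A c d → c = d

theorem finalDeck_eq_of_distinguished {n t : ℕ} {A : Fin t → Finset (Fin n)}
    (h : Distinguished A) (σ σ' : Equiv.Perm (Fin n)) : finalDeck t A σ = finalDeck t A σ' := by
  refine perm_eq_of_symm_lt_iff fun c d => ?_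
  by_cases hcd : c = d
  · simp [hcd]
  · exact finalDeck_symm_lt_iff_of_not_tied A σ σ' fun ht => hcd (h c d ht)

theorem moveToTop_map {n : ℕ} (A : Finset (Fin n)) (σ g : Equiv.Perm (Fin n)) :
    moveToTop (A.map g.toEmbedding) (σ.trans g) = (moveToTop A σ).trans g := by
  simp [moveToTop, Equiv.trans_assoc]

theorem finalDeck_map {n t : ℕ} (A : Fin t → Finset (Fin n)) (σ g : Equiv.Perm (Fin n)) :
    finalDeck t (fun s => (A s).map g.toEmbedding) (σ.trans g) = (finalDeck t A σ).trans g := by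
  induction t with
  | zero => rfl
  | succ t ih =>
    rw [finalDeck, finalDeck, ← moveToTop_map, ← ih]
    rfl

theorem tied_map_iff {n t : ℕ} (A : Fin t → Finset (Fin n)) (g : Equiv.Perm (Fin n))
    (c d : Fin n) : Tied (fun s => (A s).map g.toEmbedding) (g c) (g d) ↔ Tied A c d := by
  simp [Tied]

theorem distinguished_map_iff {n t : ℕ} (A : Fin t → Finset (Fin n)) (g : Equiv.Perm (Fin n)) :
    Distinguished (fun s => (A s).map g.toEmbedding) ↔ Distinguished A := by
  unfold Distinguished
  rw [← g.forall_congr_right]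
  refine forall_congr' fun c => ?_
  rw [← g.forall_congr_right]
  simp only [tied_map_iff, g.apply_eq_iff_eq]

/-- Relabelling the cards by `g` preserves the law of the path and turns the outcome `τ` from `σ`
into `g ∘ τ` from `g ∘ σ`. On distinguished paths the start may be reset to `σ`, so all `n!`
outcomes are equally likely. -/
theorem pathProb_distinguished_and (n : ℕ) (f : ℕ → ℝ) (t : ℕ) (σ τ : Equiv.Perm (Fin n)) :
    pathProb n f t (fun A => Distinguished A ∧ finalDeck t A σ = τ) =
      pathProb n f t Distinguished / n.factorial := by
  have key : ∀ τ', pathProb n f t (fun A => Distinguished A ∧ finalDeck t A σ = τ') =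
      pathProb n f t (fun A => Distinguished A ∧ finalDeck t A σ = τ) := by
    intro τ'
    set g : Equiv.Perm (Fin n) := τ.symm.trans τ'
    have hg : τ.trans g = τ' := by simp [g, ← Equiv.trans_assoc]
    rw [← pathProb_map g]
    refine pathProb_congr fun A => ?_
    rw [distinguished_map_iff]
    refine and_congr_right fun hA => ?_
    rw [finalDeck_eq_of_distinguished ((distinguished_map_iff A g).2 hA) σ (σ.trans g),
      finalDeck_map, ← hg]
    constructor
    · intro h
      ext x
      exact congrArg Fin.val (g.injective (congrArg (fun e : Equiv.Perm (Fin n) => e x) h))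
    · intro h; rw [h]
  have hsum : ∑ τ', pathProb n f t (fun A => Distinguished A ∧ finalDeck t A σ = τ') =
      pathProb n f t Distinguished := by
    classical
    unfold pathProb
    rw [Finset.sum_comm]
    refine Finset.sum_congr rfl fun A _ => ?_
    by_cases hA : Distinguished A <;> simp [hA]
  have hn : (n.factorial : ℝ) ≠ 0 := by positivity
  rw [← hsum, Finset.sum_congr rfl fun τ' _ => key τ']
  simp [Fintype.card_perm, hn]

theorem pathProb_distinguished_le (n : ℕ) {f : ℕ → ℝ} (hf : IsLaw n f) (t : ℕ)
    (σ τ : Equiv.Perm (Fin n)) :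
    pathProb n f t Distinguished / n.factorial ≤ (transition n f ^ t) σ τ := by
  rw [← pathProb_distinguished_and n f t σ τ, transition_pow_apply]
  exact pathProb_mono hf fun A h => h.2

/-- A tied pair keeps its order, so only distinguished paths can reverse the whole deck. -/
theorem transition_pow_reverse (n : ℕ) (f : ℕ → ℝ) (t : ℕ) (σ : Equiv.Perm (Fin n)) :
    (transition n f ^ t) σ (Fin.revPerm.trans σ) =
      pathProb n f t Distinguished / n.factorial := by
  rw [← pathProb_distinguished_and n f t σ (Fin.revPerm.trans σ), transition_pow_apply]
  refine pathProb_congr fun A => ⟨fun h => ⟨fun c d hcd => ?_, h⟩, fun h => h.2⟩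
  have h1 := finalDeck_symm_lt_iff_of_tied A σ hcd
  have h2 := finalDeck_symm_lt_iff_of_tied A σ hcd.symm
  rw [h] at h1 h2
  simp at h1 h2
  refine σ.symm.injective (le_antisymm ?_ ?_) <;> by_contra! hlt
  · exact absurd (h1.1 (by simpa using hlt)) (by simpa using hlt.le)
  · exact absurd (h2.1 (by simpa using hlt)) (by simpa using hlt.le)

theorem sum_transition_pow {n : ℕ} {f : ℕ → ℝ} (hf : IsLaw n f) (t : ℕ)
    (σ : Equiv.Perm (Fin n)) : ∑ τ, (transition n f ^ t) σ τ = 1 := by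
  classical
  simp only [transition_pow_apply, pathProb_eq_sum]
  rw [Finset.sum_comm]
  simp only [Finset.sum_ite_eq, Finset.mem_univ, if_true]
  rw [← Fintype.sum_pow, sum_weight hf, one_pow]

end InverseRiffle

/-! ### Uniqueness of the stationary distribution -/

namespace MarkovChain

variable {X : Type*} [Fintype X] [DecidableEq X]

theorem IsStationary.pow {P : Matrix X X ℝ} {π : X → ℝ} (h : IsStationary P π) (t : ℕ) (y : X) :
    ∑ x, π x * (P ^ t) x y = π y := by
  have h1 : Matrix.vecMul π P = π := funext h.2.2
  have : Matrix.vecMul π (P ^ t) = π := by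
    induction t with
    | zero => simp
    | succ t ih => rw [pow_succ, ← Matrix.vecMul_vecMul, ih, h1]
  exact congrFun this y

/-- Doeblin's argument: the difference of two stationary laws has total mass zero, so `δ` may be
subtracted from every entry of `P ^ t`. The difference is then contracted in `ℓ¹` by `1 - |X| δ <
1`, hence vanishes. -/
theorem IsStationary.eq_of_pow_ge {P : Matrix X X ℝ} {π ρ : X → ℝ} (hπ : IsStationary P π)
    (hρ : IsStationary P ρ) (t : ℕ) (hrow : ∀ x, ∑ y, (P ^ t) x y = 1) {δ : ℝ} (hδ : 0 < δ)
    (hP : ∀ x y, δ ≤ (P ^ t) x y) : π = ρ := by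
  rcases isEmpty_or_nonempty X with hX | hX
  · exact Subsingleton.elim _ _
  set h : X → ℝ := fun x => π x - ρ x
  have h0 : ∑ x, h x = 0 := by simp [h, hπ.2.1, hρ.2.1]
  have h1 : ∀ y, h y = ∑ x, h x * ((P ^ t) x y - δ) := by
    intro y
    have : ∑ x, h x * ((P ^ t) x y - δ) = ∑ x, π x * (P ^ t) x y - ∑ x, ρ x * (P ^ t) x y -
        (∑ x, h x) * δ := by
      rw [Finset.sum_mul, ← Finset.sum_sub_distrib, ← Finset.sum_sub_distrib]
      exact Finset.sum_congr rfl fun x _ => by simp only [h]; ring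
    rw [this, hπ.pow, hρ.pow, h0]
    simp [h]
  have h2 : ∑ y, |h y| ≤ (1 - Fintype.card X * δ) * ∑ x, |h x| := by
    calc ∑ y, |h y| ≤ ∑ y, ∑ x, |h x| * ((P ^ t) x y - δ) := by
          refine Finset.sum_le_sum fun y _ => ?_
          rw [h1 y]
          refine (Finset.abs_sum_le_sum_abs _ _).trans (le_of_eq ?_)
          refine Finset.sum_congr rfl fun x _ => ?_
          rw [abs_mul, abs_of_nonneg (sub_nonneg.2 (hP x y))]
      _ = (1 - Fintype.card X * δ) * ∑ x, |h x| := by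
          rw [Finset.sum_comm, Finset.mul_sum]
          refine Finset.sum_congr rfl fun x _ => ?_
          rw [← Finset.mul_sum, Finset.sum_sub_distrib, hrow]
          simp
          ring
  have hc : (0 : ℝ) < Fintype.card X * δ := by
    have : 0 < Fintype.card X := Fintype.card_pos
    positivity
  have h3 : ∑ x, |h x| = 0 := by
    have : 0 ≤ ∑ x, |h x| := Finset.sum_nonneg fun _ _ => abs_nonneg _
    nlinarith
  funext x
  have := (Finset.sum_eq_zero_iff_of_nonneg fun _ _ => abs_nonneg _).1 h3 x (Finset.mem_univ x)
  exact sub_eq_zero.1 (abs_eq_zero.1 this)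

end MarkovChain

/-! ### Separation distance as a tie probability -/

namespace InverseRiffle

theorem separation_transition {n : ℕ} {f : ℕ → ℝ} (hf : IsLaw n f) {t : ℕ}
    (hD : 0 < pathProb n f t Distinguished) {π : Equiv.Perm (Fin n) → ℝ}
    (hπ : MarkovChain.IsStationary (transition n f) π) :
    MarkovChain.separation (transition n f) π t = 1 - pathProb n f t Distinguished := by
  have hn : (0 : ℝ) < n.factorial := by positivity
  have hπ' := hπ.eq_of_pow_ge (uniform_isStationary n f hf) t (sum_transition_pow hf t)
    (δ := pathProb n f t Distinguished / n.factorial) (by positivity)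
    (pathProb_distinguished_le n hf t)
  subst hπ'
  unfold MarkovChain.separation
  have hle : ∀ σ τ, 1 - (transition n f ^ t) σ τ / (1 / (n.factorial : ℝ)) ≤
      1 - pathProb n f t Distinguished := by
    intro σ τ
    have := pathProb_distinguished_le n hf t σ τ
    rw [div_le_iff₀ hn] at this
    rw [div_div_eq_mul_div, div_one]
    linarith
  refine le_antisymm (ciSup_le fun σ => ciSup_le fun τ => hle σ τ) ?_
  have h1 : 1 - (transition n f ^ t) 1 (Fin.revPerm.trans 1) / (1 / (n.factorial : ℝ)) =
      1 - pathProb n f t Distinguished := by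
    rw [transition_pow_reverse]
    field_simp
  rw [← h1]
  refine le_trans ?_ (le_ciSup (Set.finite_range _).bddAbove 1)
  exact le_ciSup (f := fun τ => 1 - (transition n f ^ t) 1 τ / (1 / (n.factorial : ℝ)))
    (Set.finite_range _).bddAbove _

/-! ### Tie probabilities and independent Bernoulli variables -/

/-- Cards `j x` and `j y` agree on membership in `A` whenever `x` and `y` are in the same block. -/
def Respects {V B α : Type*} (β : V → B) (j : V → α) (A : Finset α) : Prop :=
  ∀ x y, β x = β y → (j x ∈ A ↔ j y ∈ A)

section Counting

variable {V B α : Type*} [Fintype V] [DecidableEq α]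

-- Membership respects the blocks iff it factors through a colouring of the blocks, unique because
-- `β` is surjective. The indicator becomes a sum of products over `V`, so that summation over all
-- maps `j` factorizes.
open Classical in
theorem ite_respects_eq_sum [Fintype B] [DecidableEq B] {β : V → B}
    (hβ : Function.Surjective β) (j : V → α) (A : Finset α) :
    (if Respects β j A then (1 : ℝ) else 0) =
      ∑ χ : B → Bool, ∏ x, if (j x ∈ A ↔ χ (β x) = true) then (1 : ℝ) else 0 := by
  simp only [Fintype.prod_ite_zero, Finset.prod_const_one]
  split_ifs with h
  · rw [Finset.sum_eq_single fun b => decide (j (Function.surjInv hβ b) ∈ A)]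
    · rw [if_pos]
      intro x
      simpa using h _ _ (Function.surjInv_eq hβ (β x)).symm
    · intro χ _ hχ
      refine if_neg fun h' => hχ (funext fun b => ?_)
      have := h' (Function.surjInv hβ b)
      rw [Function.surjInv_eq hβ] at this
      simp [this]
    · simp
  · refine (Finset.sum_eq_zero fun χ _ => if_neg fun h' => h fun x y hxy => ?_).symm
    rw [h', h', hxy]

open Classical in
theorem sum_ite_respects [Fintype B] [DecidableEq B] [Fintype α] {β : V → B}
    (hβ : Function.Surjective β) (A : Finset α) :
    ∑ j : V → α, (if Respects β j A then (1 : ℝ) else 0) =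
      ∏ b, ((A.card : ℝ) ^ (Finset.univ.filter fun x => β x = b).card +
        ((Fintype.card α : ℝ) - A.card) ^ (Finset.univ.filter fun x => β x = b).card) := by
  simp only [ite_respects_eq_sum hβ]
  rw [Finset.sum_comm]
  have h1 : ∀ χ : B → Bool,
      ∑ j : V → α, ∏ x, (if (j x ∈ A ↔ χ (β x) = true) then (1 : ℝ) else 0) =
        ∏ b, (if χ b = true then (A.card : ℝ) else (Fintype.card α : ℝ) - A.card) ^
          (Finset.univ.filter fun x => β x = b).card := by
    intro χ
    have h2 := Finset.prod_univ_sum (fun _ : V => (Finset.univ : Finset α))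
      (fun x i => if (i ∈ A ↔ χ (β x) = true) then (1 : ℝ) else 0)
    rw [Fintype.piFinset_univ] at h2
    rw [← h2, ← Finset.prod_fiberwise (Finset.univ : Finset V) β]
    refine Finset.prod_congr rfl fun b _ => ?_
    refine Finset.prod_eq_pow_card fun x hx => ?_
    rw [(Finset.mem_filter.1 hx).2]
    cases χ b
    · simp only [Bool.false_eq_true, iff_false, if_false, Finset.sum_boole]
      rw [← Finset.compl_filter, Finset.card_compl, Nat.cast_sub (Finset.card_le_univ _)]
      simp
    · simp
  simp only [h1]
  have h3 := Finset.prod_univ_sum (fun _ : B => (Finset.univ : Finset Bool))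
    (fun b c => (if c = true then (A.card : ℝ) else (Fintype.card α : ℝ) - A.card) ^
          (Finset.univ.filter fun x => β x = b).card)
  rw [Fintype.piFinset_univ] at h3
  rw [← h3]
  simp

open Classical in
theorem sum_embedding_respects_le [Fintype α] (β : V → B) (A : Finset α) :
    ∑ j : V ↪ α, (if Respects β j A then (1 : ℝ) else 0) ≤
      ∑ j : V → α, (if Respects β j A then (1 : ℝ) else 0) := by
  rw [← Finset.sum_image (s := Finset.univ) (g := fun j : V ↪ α => (j : V → α))
    (f := fun j : V → α => if Respects β j A then (1 : ℝ) else 0)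
    (fun _ _ _ _ h => DFunLike.coe_injective h)]
  exact Finset.sum_le_sum_of_subset_of_nonneg (Finset.subset_univ _)
    fun _ _ _ => by split_ifs <;> norm_num

-- The last term counts the non-injective maps, each contributing at most one.
open Classical in
theorem sum_respects_le_sum_embedding_add [Fintype α] (β : V → B) (A : Finset α) :
    ∑ j : V → α, (if Respects β j A then (1 : ℝ) else 0) ≤
      ∑ j : V ↪ α, (if Respects β j A then (1 : ℝ) else 0) +
        ((Fintype.card α : ℝ) ^ Fintype.card V -
          ((Fintype.card α).descFactorial (Fintype.card V) : ℝ)) := by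
  set I := Finset.univ.image fun j : V ↪ α => (j : V → α)
  rw [← Finset.sum_image (s := Finset.univ) (g := fun j : V ↪ α => (j : V → α))
    (f := fun j : V → α => if Respects β j A then (1 : ℝ) else 0)
    (fun _ _ _ _ h => DFunLike.coe_injective h)]
  rw [← Finset.sum_add_sum_compl I]
  gcongr
  have hI : I.card = (Fintype.card α).descFactorial (Fintype.card V) := by
    rw [Finset.card_image_of_injective _ DFunLike.coe_injective, Finset.card_univ,
      Fintype.card_embedding_eq]
  have hc : (Iᶜ.card : ℝ) = (Fintype.card α : ℝ) ^ Fintype.card V -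
      ((Fintype.card α).descFactorial (Fintype.card V) : ℝ) := by
    rw [Finset.card_compl, Nat.cast_sub (Finset.card_le_univ _), hI]
    simp
  rw [← hc, ← nsmul_one, ← Finset.sum_const]
  exact Finset.sum_le_sum fun _ _ => by split_ifs <;> norm_num

end Counting

/-- For `v < n` this is Bernoulli's inequality applied to `(1 - v/n)^v`; otherwise the right side is
at least one. -/
theorem one_sub_descFactorial_div_pow_le {n : ℕ} (hn : 1 ≤ n) (v : ℕ) :
    1 - (n.descFactorial v : ℝ) / (n : ℝ) ^ v ≤ (v : ℝ) ^ 2 / n := by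
  have hn' : (0 : ℝ) < n := by exact_mod_cast hn
  rcases le_or_gt n v with h | h
  · have h1 : (1 : ℝ) ≤ (v : ℝ) ^ 2 / n := by
      rw [le_div_iff₀ hn', one_mul]
      have : (n : ℝ) ≤ v := by exact_mod_cast h
      have : (1 : ℝ) ≤ n := by exact_mod_cast hn
      nlinarith
    have : 0 ≤ (n.descFactorial v : ℝ) / (n : ℝ) ^ v := by positivity
    linarith
  · have h1 : ((n - v : ℝ)) ^ v ≤ n.descFactorial v := by
      have h2 := Nat.pow_sub_le_descFactorial n v
      have h3 : (n - v) ^ v ≤ n.descFactorial v :=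
        (Nat.pow_le_pow_left (by omega) v).trans h2
      have h4 : (((n - v : ℕ) : ℝ)) ^ v ≤ n.descFactorial v := by exact_mod_cast h3
      rwa [Nat.cast_sub h.le] at h4
    have h5 := one_add_mul_le_pow (a := -((v : ℝ) / n)) (by
      have : (v : ℝ) / n ≤ 1 := (div_le_one hn').2 (by exact_mod_cast h.le)
      linarith) v
    have h6 : (1 + -((v : ℝ) / n)) ^ v = (n - v : ℝ) ^ v / (n : ℝ) ^ v := by
      rw [← div_pow]; congr 1; field_simp; ring
    rw [h6] at h5
    have h7 : (n - v : ℝ) ^ v / (n : ℝ) ^ v ≤ (n.descFactorial v : ℝ) / (n : ℝ) ^ v := by gcongr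
    have h8 : (v : ℝ) * -((v : ℝ) / n) = - ((v : ℝ) ^ 2 / n) := by ring
    linarith

/-- The one-step probability that the selected set respects the blocks of `β` on the cards `j`. -/
noncomputable def tieProbAt {V B : Type*} (n : ℕ) (f : ℕ → ℝ) (β : V → B) (j : V → Fin n) : ℝ :=
  open Classical in ∑ A, if Respects β j A then weight n f A else 0

/-- The average of `tieProbAt` over all placements of distinct cards. -/
noncomputable def tieProb {V B : Type*} [Fintype V] (n : ℕ) (f : ℕ → ℝ) (β : V → B) : ℝ :=
  (∑ j : V ↪ Fin n, tieProbAt n f β j) / n.descFactorial (Fintype.card V)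

/-- Some permutation carries one placement to the other, and weights depend only on cardinality. -/
theorem tieProbAt_eq {V B : Type*} [Finite V] (n : ℕ) (f : ℕ → ℝ) (β : V → B) (j j' : V ↪ Fin n) :
    tieProbAt n f β j = tieProbAt n f β j' := by
  obtain ⟨g, hg⟩ := Equiv.Perm.exists_extending_pair j j' j.injective j'.injective
  refine Fintype.sum_equiv g.finsetCongr _ _ fun A => ?_
  have : Respects β j' (A.map g.toEmbedding) ↔ Respects β j A := by
    simp [Respects, ← hg]
  by_cases h : Respects β j A
  · simp [h, this.2 h, weight_map]
  · simp [h, mt this.1 h]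

theorem tieProbAt_eq_tieProb {V B : Type*} [Fintype V] (n : ℕ) (f : ℕ → ℝ)
    (β : V → B) (j : V ↪ Fin n) :
    tieProbAt n f β j = tieProb n f β := by
  have hc : Fintype.card (V ↪ Fin n) = n.descFactorial (Fintype.card V) := by
    rw [Fintype.card_embedding_eq, Fintype.card_fin]
  have h0 : (n.descFactorial (Fintype.card V) : ℝ) ≠ 0 := by
    rw [← hc]
    have : Nonempty (V ↪ Fin n) := ⟨j⟩
    exact_mod_cast Fintype.card_ne_zero
  unfold tieProb
  rw [Finset.sum_congr rfl fun j' _ => tieProbAt_eq n f β j' j, Finset.sum_const,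
    Finset.card_univ, hc, nsmul_eq_mul]
  field_simp

theorem pathProb_tied {V B : Type*} [Fintype V] (n : ℕ) (f : ℕ → ℝ) (t : ℕ)
    (β : V → B) (j : V ↪ Fin n) :
    pathProb n f t (fun A => ∀ x y, β x = β y → Tied A (j x) (j y)) = tieProb n f β ^ t := by
  classical
  rw [← tieProbAt_eq_tieProb n f β j, tieProbAt]
  have := pathProb_forall (n := n) (f := f) (t := t) (Respects β j)
  rw [← this]
  refine pathProb_congr fun A => ?_
  exact ⟨fun h s x y hxy => h x y hxy s, fun h x y hxy s => h s x y hxy⟩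

/-- `𝔼[h(K / n)]` for `K` with law `f`. -/
noncomputable def pileExp (n : ℕ) (f : ℕ → ℝ) (h : ℝ → ℝ) : ℝ :=
  ∑ k ∈ Finset.Icc 1 n, f k * h ((k : ℝ) / n)

/-- The probability that independent Bernoulli variables with parameter `y`, indexed by `V`, are
constant on the blocks of `β`. -/
noncomputable def blockPoly {V B : Type*} [Fintype V] [Fintype B] [DecidableEq B]
    (β : V → B) (y : ℝ) : ℝ :=
  ∏ b, (y ^ (Finset.univ.filter fun x => β x = b).card +
    (1 - y) ^ (Finset.univ.filter fun x => β x = b).card)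

theorem tieProbAt_nonneg {V B : Type*} {n : ℕ} {f : ℕ → ℝ} (hf : IsLaw n f)
    (β : V → B) (j : V → Fin n) :
    0 ≤ tieProbAt n f β j :=
  Finset.sum_nonneg fun A _ => by split_ifs; exacts [weight_nonneg hf A, le_rfl]

theorem tieProb_nonneg {V B : Type*} [Fintype V] {n : ℕ} {f : ℕ → ℝ} (hf : IsLaw n f) (β : V → B) :
    0 ≤ tieProb n f β :=
  div_nonneg (Finset.sum_nonneg fun j _ => tieProbAt_nonneg hf β j) (by positivity)

/-- Sampling cards without or with replacement differs only through collisions. With `S`, `T` the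
weighted counts of respecting injective and arbitrary placements, and `a`, `b` the numbers of such
placements, `S ≤ T ≤ S + (b - a)` and `S ≤ a`, so `S/a` and `T/b` differ by at most `(b - a)/b`. -/
theorem abs_tieProb_sub_le {V B : Type*} [Fintype V] [Fintype B] [DecidableEq B]
    {n : ℕ} {f : ℕ → ℝ} (hf : IsLaw n f) {β : V → B}
    (hβ : Function.Surjective β) (hn : 1 ≤ n) (hV : Fintype.card V ≤ n) :
    |tieProb n f β - pileExp n f (blockPoly β)| ≤ (Fintype.card V : ℝ) ^ 2 / n := by
  classical
  have hn' : (0 : ℝ) < n := by exact_mod_cast hn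
  set v := Fintype.card V with hv
  set a : ℝ := (n.descFactorial v : ℝ) with ha
  set b : ℝ := (n : ℝ) ^ v with hb
  have ha0 : 0 < a := by
    rw [ha]; exact_mod_cast Nat.descFactorial_pos.2 hV
  have hb0 : 0 < b := by positivity
  have hab : a ≤ b := by
    rw [ha, hb]; exact_mod_cast Nat.descFactorial_le_pow n v
  set S := ∑ j : V ↪ Fin n, tieProbAt n f β j with hS
  set T := b * pileExp n f (blockPoly β) with hT
  have hS' : S = ∑ A, weight n f A *
      ∑ j : V ↪ Fin n, (if Respects β j A then (1 : ℝ) else 0) := by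
    rw [hS]
    unfold tieProbAt
    rw [Finset.sum_comm]
    refine Finset.sum_congr rfl fun A _ => ?_
    rw [Finset.mul_sum]
    refine Finset.sum_congr rfl fun j _ => ?_
    split_ifs <;> simp
  have hT' : T = ∑ A, weight n f A *
      ∑ j : V → Fin n, (if Respects β j A then (1 : ℝ) else 0) := by
    simp only [sum_ite_respects hβ]
    rw [sum_weight_mul_card n f (fun k => ∏ b, ((k : ℝ) ^ (Finset.univ.filter fun x => β x = b).card +
        ((Fintype.card (Fin n) : ℝ) - k) ^ (Finset.univ.filter fun x => β x = b).card)), hT,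
      pileExp, Finset.mul_sum]
    refine Finset.sum_congr rfl fun k _ => ?_
    rw [mul_left_comm]
    congr 1
    have hbp : b = ∏ b : B, (n : ℝ) ^ (Finset.univ.filter fun x => β x = b).card := by
      rw [Finset.prod_pow_eq_pow_sum, hb, hv, ← Finset.card_univ,
        Finset.card_eq_sum_card_fiberwise (f := β) (t := Finset.univ) (by simp)]
    rw [hbp, blockPoly, ← Finset.prod_mul_distrib]
    refine Finset.prod_congr rfl fun b _ => ?_
    rw [mul_add, ← mul_pow, ← mul_pow, Fintype.card_fin]
    congr 2 <;> field_simp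
  have h1 : S ≤ T := by
    rw [hS', hT']
    exact Finset.sum_le_sum fun A _ =>
      mul_le_mul_of_nonneg_left (sum_embedding_respects_le β A) (weight_nonneg hf A)
  have h2 : T ≤ S + (b - a) := by
    have : ∑ A, weight n f A * (∑ j : V ↪ Fin n, (if Respects β j A then (1 : ℝ) else 0) +
        (b - a)) = S + (b - a) := by
      simp only [mul_add, Finset.sum_add_distrib, ← Finset.sum_mul, sum_weight hf, one_mul, ← hS']
    rw [← this, hT']
    refine Finset.sum_le_sum fun A _ => mul_le_mul_of_nonneg_left ?_ (weight_nonneg hf A)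
    simpa using sum_respects_le_sum_embedding_add β A
  have h3 : S ≤ a := by
    have hc : ∑ j : V ↪ Fin n, (1 : ℝ) = a := by
      simp [Fintype.card_embedding_eq, ha, hv]
    have : ∑ A, weight n f A * a = a := by rw [← Finset.sum_mul, sum_weight hf, one_mul]
    rw [← this, hS']
    refine Finset.sum_le_sum fun A _ => mul_le_mul_of_nonneg_left ?_ (weight_nonneg hf A)
    rw [← hc]
    exact Finset.sum_le_sum fun _ _ => by split_ifs <;> norm_num
  have h0 : 0 ≤ S := Finset.sum_nonneg fun j _ => tieProbAt_nonneg hf β j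
  have h4 : (b - a) / b ≤ (v : ℝ) ^ 2 / n := by
    have := one_sub_descFactorial_div_pow_le hn v
    rwa [sub_div, div_self hb0.ne']
  refine le_trans ?_ h4
  have hE : pileExp n f (blockPoly β) = T / b := by rw [hT]; field_simp
  have hP : tieProb n f β = S / a := rfl
  rw [hE, hP, abs_le]
  constructor
  · have : T / b ≤ S / b + (b - a) / b := by rw [← add_div]; gcongr
    have : S / b ≤ S / a := by gcongr
    linarith
  · have h5 : S / b ≤ T / b := by gcongr
    have h6 : S / a - S / b = (S / a) * ((b - a) / b) := by field_simp
    have h7 : (S / a) * ((b - a) / b) ≤ 1 * ((b - a) / b) :=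
      mul_le_mul_of_nonneg_right ((div_le_one ha0).2 h3) (div_nonneg (by linarith) hb0.le)
    linarith

/-! ### Second-order expansion around the mean pile size -/

section pileExp

variable {n : ℕ} {f : ℕ → ℝ}

theorem div_mem_Icc_of_mem_Icc {k : ℕ} (hk : k ∈ Finset.Icc 1 n) :
    (k : ℝ) / n ∈ Set.Icc (0 : ℝ) 1 := by
  have h := Finset.mem_Icc.1 hk
  have hn : (0 : ℝ) < n := by exact_mod_cast h.1.trans h.2
  exact ⟨by positivity, (div_le_one hn).2 (by exact_mod_cast h.2)⟩

theorem pileMean_mem_Icc (hf : IsLaw n f) : pileMean n f ∈ Set.Icc (0 : ℝ) 1 := by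
  constructor
  · exact Finset.sum_nonneg fun k hk => mul_nonneg (hf.1 k hk) (div_mem_Icc_of_mem_Icc hk).1
  · rw [← hf.2]
    exact Finset.sum_le_sum fun k hk =>
      mul_le_of_le_one_right (hf.1 k hk) (div_mem_Icc_of_mem_Icc hk).2

/-- The linear term has mean zero because the expansion is centred at the mean. -/
theorem abs_pileExp_sub_le (hf : IsLaw n f) {h : ℝ → ℝ} {a b C : ℝ}
    (hh : ∀ y ∈ Set.Icc (0 : ℝ) 1,
      |h y - a - b * (y - pileMean n f)| ≤ C * (y - pileMean n f) ^ 2) :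
    |pileExp n f h - a| ≤ C * pileVariance n f := by
  have h1 : ∑ k ∈ Finset.Icc 1 n, f k * ((k : ℝ) / n - pileMean n f) = 0 := by
    simp only [mul_sub, Finset.sum_sub_distrib, ← Finset.sum_mul, hf.2]
    simp [pileMean]
  have h2 : pileExp n f h - a = ∑ k ∈ Finset.Icc 1 n, f k *
      (h ((k : ℝ) / n) - a - b * ((k : ℝ) / n - pileMean n f)) := by
    have : ∀ k ∈ Finset.Icc 1 n, f k * (h ((k : ℝ) / n) - a - b * ((k : ℝ) / n - pileMean n f)) =
        f k * h ((k : ℝ) / n) - f k * a - b * (f k * ((k : ℝ) / n - pileMean n f)) :=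
      fun k _ => by ring
    rw [Finset.sum_congr rfl this, Finset.sum_sub_distrib, Finset.sum_sub_distrib,
      ← Finset.mul_sum, h1, ← Finset.sum_mul, hf.2, pileExp]
    ring
  rw [h2, pileVariance, Finset.mul_sum]
  refine (Finset.abs_sum_le_sum_abs _ _).trans (Finset.sum_le_sum fun k hk => ?_)
  rw [abs_mul, abs_of_nonneg (hf.1 k hk), mul_left_comm]
  exact mul_le_mul_of_nonneg_left (hh _ (div_mem_Icc_of_mem_Icc hk)) (hf.1 k hk)

/-- Taylor's formula with `b = r m^(r-1)`, built through the recursion `b ↦ m^r + m b`; the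
constants are crude. -/
theorem exists_abs_pow_sub_pow_sub_le {m : ℝ} (hm : m ∈ Set.Icc (0 : ℝ) 1) (r : ℕ) :
    ∃ b : ℝ, |b| ≤ r ∧ ∀ x ∈ Set.Icc (0 : ℝ) 1,
      |x ^ r - m ^ r - b * (x - m)| ≤ (r : ℝ) ^ 2 * (x - m) ^ 2 := by
  induction r with
  | zero => exact ⟨0, by simp, fun x _ => by simp⟩
  | succ r ih =>
    obtain ⟨b, hb, h⟩ := ih
    refine ⟨m ^ r + m * b, ?_, fun x hx => ?_⟩
    · have h1 : |m ^ r| ≤ 1 := by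
        rw [abs_of_nonneg (pow_nonneg hm.1 r)]; exact pow_le_one₀ hm.1 hm.2
      have h2 : |m * b| ≤ r := by
        rw [abs_mul, abs_of_nonneg hm.1]
        exact (mul_le_of_le_one_left (abs_nonneg b) hm.2).trans hb
      push_cast
      linarith [abs_add_le (m ^ r) (m * b)]
    · have h1 : x ^ (r + 1) - m ^ (r + 1) - (m ^ r + m * b) * (x - m) =
          x * (x ^ r - m ^ r - b * (x - m)) + b * (x - m) ^ 2 := by ring
      have h2 : |x * (x ^ r - m ^ r - b * (x - m))| ≤ (r : ℝ) ^ 2 * (x - m) ^ 2 := by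
        rw [abs_mul, abs_of_nonneg hx.1]
        exact (mul_le_of_le_one_left (abs_nonneg _) hx.2).trans (h x hx)
      have h3 : |b * (x - m) ^ 2| ≤ r * (x - m) ^ 2 := by
        rw [abs_mul, abs_of_nonneg (sq_nonneg (x - m))]
        exact mul_le_mul_of_nonneg_right hb (sq_nonneg _)
      rw [h1]
      refine (abs_add_le _ _).trans ((add_le_add h2 h3).trans ?_)
      push_cast
      nlinarith [sq_nonneg (x - m), mul_nonneg (Nat.cast_nonneg (α := ℝ) r) (sq_nonneg (x - m))]

/-- The probability that two independent Bernoulli variables with parameter `y` agree. -/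
noncomputable def agree (y : ℝ) : ℝ := y ^ 2 + (1 - y) ^ 2

theorem agree_mem_Icc {y : ℝ} (hy : y ∈ Set.Icc (0 : ℝ) 1) : agree y ∈ Set.Icc (0 : ℝ) 1 := by
  unfold agree
  constructor
  · positivity
  · nlinarith [hy.1, hy.2]

theorem abs_pileExp_agree_pow_sub_le (hf : IsLaw n f) (r : ℕ) :
    |pileExp n f (fun y => agree y ^ r) - agree (pileMean n f) ^ r| ≤
      (4 * (r : ℝ) ^ 2 + 2 * r) * pileVariance n f := by
  have hμ := pileMean_mem_Icc hf
  set m := pileMean n f with hm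
  obtain ⟨b, hb, h⟩ := exists_abs_pow_sub_pow_sub_le (agree_mem_Icc hμ) r
  -- Chain rule: `4 * m - 2` is the derivative of `agree` at `m`.
  refine abs_pileExp_sub_le (b := b * (4 * m - 2)) hf fun y hy => ?_
  rw [← hm]
  have h1 := h _ (agree_mem_Icc hy)
  have h2 : agree y - agree m = 2 * (y - m) * (y + m - 1) := by unfold agree; ring
  have h3 : (agree y - agree m) ^ 2 ≤ 4 * (y - m) ^ 2 := by
    rw [h2, mul_pow]
    have : (y + m - 1) ^ 2 ≤ 1 := by nlinarith [hy.1, hy.2, hμ.1, hμ.2]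
    nlinarith [mul_le_mul_of_nonneg_left this (sq_nonneg (2 * (y - m)))]
  have h4 : agree y ^ r - agree m ^ r - b * (4 * m - 2) * (y - m) =
      (agree y ^ r - agree m ^ r - b * (agree y - agree m)) + b * (2 * (y - m) ^ 2) := by
    rw [h2]; ring
  have h5 : |b * (2 * (y - m) ^ 2)| ≤ r * (2 * (y - m) ^ 2) := by
    rw [abs_mul, abs_of_nonneg (by positivity : (0 : ℝ) ≤ 2 * (y - m) ^ 2)]
    exact mul_le_mul_of_nonneg_right hb (by positivity)
  rw [h4]
  refine (abs_add_le _ _).trans ((add_le_add h1 h5).trans ?_)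
  nlinarith [mul_le_mul_of_nonneg_left h3 (sq_nonneg (r : ℝ))]

theorem abs_qTwo_sub_le (hf : IsLaw n f) (hn : 2 ≤ n) :
    |qTwo n f - pileExp n f agree| ≤ 1 / n := by
  have hn' : (2 : ℝ) ≤ n := by exact_mod_cast hn
  have h1 : ∀ k ∈ Finset.Icc 1 n, |((k.choose 2 : ℝ) + ((n - k).choose 2 : ℝ)) / (n.choose 2 : ℝ) -
      agree ((k : ℝ) / n)| ≤ 1 / n := by
    intro k hk
    have hkn := (Finset.mem_Icc.1 hk).2
    have hk1 : (k : ℝ) ≤ n := by exact_mod_cast hkn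
    have h : ((k.choose 2 : ℝ) + ((n - k).choose 2 : ℝ)) / (n.choose 2 : ℝ) -
        agree ((k : ℝ) / n) = - (2 * k * (n - k) / (n ^ 2 * (n - 1))) := by
      have h3 : (n : ℝ) - 1 ≠ 0 := by linarith
      rw [Nat.cast_choose_two, Nat.cast_choose_two, Nat.cast_choose_two, Nat.cast_sub hkn, agree]
      field_simp
      ring
    have h4 : 0 ≤ 2 * k * (n - k : ℝ) / (n ^ 2 * (n - 1)) :=
      div_nonneg (mul_nonneg (by positivity) (by linarith))
        (mul_nonneg (by positivity) (by linarith))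
    rw [h, abs_neg, abs_of_nonneg h4, div_le_div_iff₀ (by
      have : (0 : ℝ) < n - 1 := by linarith
      positivity) (by linarith)]
    -- The worst case is `k = n / 2`, where the discrepancy is `1 / (2 (n - 1)) ≤ 1 / n`.
    have h5 : 2 * k * (n - k : ℝ) ≤ n ^ 2 / 2 := by nlinarith [sq_nonneg (2 * (k : ℝ) - n)]
    nlinarith
  rw [qTwo, pileExp, ← Finset.sum_sub_distrib]
  refine (Finset.abs_sum_le_sum_abs _ _).trans ?_
  have h2 : ∑ k ∈ Finset.Icc 1 n, f k * (1 / (n : ℝ)) = 1 / n := by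
    rw [← Finset.sum_mul, hf.2, one_mul]
  rw [← h2]
  refine Finset.sum_le_sum fun k hk => ?_
  rw [← mul_sub, abs_mul, abs_of_nonneg (hf.1 k hk)]
  exact mul_le_mul_of_nonneg_left (h1 k hk) (hf.1 k hk)

theorem qTwo_mem_Icc (hf : IsLaw n f) : qTwo n f ∈ Set.Icc (0 : ℝ) 1 := by
  constructor
  · exact Finset.sum_nonneg fun k hk => mul_nonneg (hf.1 k hk) (by positivity)
  · rw [← hf.2]
    refine Finset.sum_le_sum fun k hk => mul_le_of_le_one_right (hf.1 k hk) ?_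
    refine div_le_one_of_le₀ ?_ (by positivity)
    have hkn := (Finset.mem_Icc.1 hk).2
    have hk1 : (k : ℝ) ≤ n := by exact_mod_cast hkn
    rw [Nat.cast_choose_two, Nat.cast_choose_two, Nat.cast_choose_two, Nat.cast_sub hkn]
    nlinarith [mul_nonneg (Nat.cast_nonneg (α := ℝ) k) (sub_nonneg.2 hk1)]

end pileExp

theorem blockPoly_fst (r : ℕ) :
    blockPoly (Prod.fst : Fin r × Bool → Fin r) = fun y => agree y ^ r := by
  funext y
  have h : ∀ b : Fin r, (Finset.univ.filter fun x : Fin r × Bool => x.1 = b).card = 2 := by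
    intro b
    rw [← Finset.univ_product_univ, Finset.filter_product_left (fun x => x = b),
      Finset.card_product]
    simp [Finset.filter_eq']
  simp [blockPoly, h, agree]

/-- Both quantities are compared with `agree (pileMean n f) ^ r`, from which each differs by a
multiple of `1/n` and of the variance. -/
theorem abs_tieProb_fst_sub_qTwo_pow_le {n : ℕ} {f : ℕ → ℝ} (hf : IsLaw n f) (r : ℕ) (hn : 2 ≤ n)
    (hr : 2 * r ≤ n) :
    |tieProb n f (Prod.fst : Fin r × Bool → Fin r) - qTwo n f ^ r| ≤
      (4 * (r : ℝ) ^ 2 + r) * (1 / n) + (4 * (r : ℝ) ^ 2 + 8 * r) * pileVariance n f := by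
  have h1 := abs_tieProb_sub_le hf (β := (Prod.fst : Fin r × Bool → Fin r))
    Prod.fst_surjective (by omega) (by simpa [mul_comm] using hr)
  rw [blockPoly_fst] at h1
  have h2 := abs_pileExp_agree_pow_sub_le hf r
  have h3 := abs_pileExp_agree_pow_sub_le hf 1
  simp only [pow_one] at h3
  have h4 := abs_qTwo_sub_le hf hn
  have hm := agree_mem_Icc (pileMean_mem_Icc hf)
  have hq := qTwo_mem_Icc hf
  have h5 : |agree (pileMean n f) ^ r - qTwo n f ^ r| ≤
      r * |agree (pileMean n f) - qTwo n f| := by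
    refine (abs_pow_sub_pow_le _ _ _).trans ?_
    rw [mul_comm (r : ℝ)]
    refine mul_le_of_le_one_right (by positivity) (pow_le_one₀ (by positivity) ?_)
    rw [abs_of_nonneg hm.1, abs_of_nonneg hq.1]
    exact max_le hm.2 hq.2
  have h6 : |agree (pileMean n f) - qTwo n f| ≤ 1 / n + 6 * pileVariance n f := by
    have : agree (pileMean n f) - qTwo n f =
      -(pileExp n f agree - agree (pileMean n f)) - (qTwo n f - pileExp n f agree) := by ring
    rw [this]
    refine (abs_sub _ _).trans ?_
    rw [abs_neg]
    push_cast at h3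
    linarith
  have h7 := mul_le_mul_of_nonneg_left h6 (Nat.cast_nonneg (α := ℝ) r)
  have h8 : ((Fintype.card (Fin r × Bool) : ℕ) : ℝ) ^ 2 / n = 4 * (r : ℝ) ^ 2 * (1 / n) := by
    simp; ring
  rw [h8] at h1
  have h9 := abs_sub_le (tieProb n f (Prod.fst : Fin r × Bool → Fin r))
    (pileExp n f fun y => agree y ^ r) (qTwo n f ^ r)
  have h10 := abs_sub_le (pileExp n f fun y => agree y ^ r) (agree (pileMean n f) ^ r)
    (qTwo n f ^ r)
  linarith

/-! ### Limits under convergence in probability -/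

theorem tendsto_pileExp {f : ℕ → ℕ → ℝ} (hf : ∀ n, 1 ≤ n → IsLaw n (f n)) {α : ℝ}
    (hα : α ∈ Set.Ioo (0 : ℝ) 1)
    (hprob : ∀ ε : ℝ, 0 < ε → Tendsto (fun n => deviationProb n (f n) α ε) atTop (𝓝 0))
    {h : ℝ → ℝ} (hh : Continuous h) :
    Tendsto (fun n => pileExp n (f n) h) atTop (𝓝 (h α)) := by
  rw [Metric.tendsto_atTop]
  intro ε hε
  obtain ⟨δ, hδ, hδ'⟩ := Metric.continuousAt_iff.1 hh.continuousAt (ε / 2) (by positivity)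
  obtain ⟨M, hM⟩ := isCompact_Icc.exists_bound_of_continuousOn (hh.continuousOn (s := Set.Icc 0 1))
  have hM0 : 0 ≤ M := (norm_nonneg _).trans (hM α ⟨hα.1.le, hα.2.le⟩)
  obtain ⟨N, hN⟩ := Metric.tendsto_atTop.1 (hprob δ hδ) (ε / (4 * M + 1)) (by positivity)
  refine ⟨max N 1, fun n hn => ?_⟩
  have hn1 : 1 ≤ n := (le_max_right _ _).trans hn
  have hl := hf n hn1
  have hd := hN n ((le_max_left _ _).trans hn)
  rw [Real.dist_eq, sub_zero] at hd
  have hd' := (le_abs_self _).trans_lt hd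
  have h1 : pileExp n (f n) h - h α =
      ∑ k ∈ Finset.Icc 1 n, f n k * (h ((k : ℝ) / n) - h α) := by
    simp only [mul_sub, Finset.sum_sub_distrib, ← Finset.sum_mul, hl.2, pileExp, one_mul]
  have h2 : |pileExp n (f n) h - h α| ≤ ε / 2 + 2 * M * deviationProb n (f n) α δ := by
    have h3 : ε / 2 + 2 * M * deviationProb n (f n) α δ = ∑ k ∈ Finset.Icc 1 n,
        (f n k * (ε / 2) + 2 * M * if δ ≤ |(k : ℝ) / n - α| then f n k else 0) := by
      rw [Finset.sum_add_distrib, ← Finset.sum_mul, hl.2, ← Finset.mul_sum, deviationProb,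
        Finset.sum_filter, one_mul]
    rw [h1, h3]
    refine (Finset.abs_sum_le_sum_abs _ _).trans (Finset.sum_le_sum fun k hk => ?_)
    rw [abs_mul, abs_of_nonneg (hl.1 k hk)]
    have hfk := hl.1 k hk
    split_ifs with hdev
    · have a1 := hM _ (div_mem_Icc_of_mem_Icc hk)
      have a2 := hM α ⟨hα.1.le, hα.2.le⟩
      rw [Real.norm_eq_abs] at a1 a2
      have a3 : |h ((k : ℝ) / n) - h α| ≤ 2 * M := (abs_sub _ _).trans (by linarith)
      nlinarith [mul_le_mul_of_nonneg_left a3 hfk, mul_nonneg hfk hε.le]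
    · have a1 := hδ' (show dist ((k : ℝ) / n) α < δ from not_le.1 hdev)
      rw [Real.dist_eq] at a1
      rw [mul_zero, add_zero]
      exact mul_le_mul_of_nonneg_left a1.le hfk
  rw [Real.dist_eq]
  refine h2.trans_lt ?_
  have h4 : 2 * M * deviationProb n (f n) α δ ≤ 2 * M * (ε / (4 * M + 1)) :=
    mul_le_mul_of_nonneg_left hd'.le (by positivity)
  have h5 : 2 * M * (ε / (4 * M + 1)) < ε / 2 := by
    rw [← mul_div_assoc, div_lt_div_iff₀ (by positivity) (by norm_num)]
    nlinarith
  linarith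

theorem tendsto_qTwo {f : ℕ → ℕ → ℝ} (hf : ∀ n, 1 ≤ n → IsLaw n (f n)) {α : ℝ}
    (hα : α ∈ Set.Ioo (0 : ℝ) 1)
    (hprob : ∀ ε : ℝ, 0 < ε → Tendsto (fun n => deviationProb n (f n) α ε) atTop (𝓝 0)) :
    Tendsto (fun n => qTwo n (f n)) atTop (𝓝 (agree α)) := by
  have h1 := tendsto_pileExp hf hα hprob (h := agree) (by unfold agree; fun_prop)
  have h2 : Tendsto (fun n => qTwo n (f n) - pileExp n (f n) agree) atTop (𝓝 0) := by
    refine squeeze_zero_norm' ?_ tendsto_one_div_atTop_nhds_zero_nat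
    filter_upwards [eventually_ge_atTop 2] with n hn
    exact abs_qTwo_sub_le (hf n (by omega)) hn
  simpa using h2.add h1

theorem tendsto_tieProb {f : ℕ → ℕ → ℝ} (hf : ∀ n, 1 ≤ n → IsLaw n (f n)) {α : ℝ}
    (hα : α ∈ Set.Ioo (0 : ℝ) 1)
    (hprob : ∀ ε : ℝ, 0 < ε → Tendsto (fun n => deviationProb n (f n) α ε) atTop (𝓝 0))
    {V B : Type*} [Fintype V] [Fintype B] [DecidableEq B] {β : V → B}
    (hβ : Function.Surjective β) :
    Tendsto (fun n => tieProb n (f n) β) atTop (𝓝 (blockPoly β α)) := by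
  have h1 := tendsto_pileExp hf hα hprob (h := blockPoly β) (by unfold blockPoly; fun_prop)
  have h2 : Tendsto (fun n => tieProb n (f n) β - pileExp n (f n) (blockPoly β)) atTop (𝓝 0) := by
    refine squeeze_zero_norm' ?_ (tendsto_const_div_atTop_nhds_zero_nat
      ((Fintype.card V : ℝ) ^ 2))
    filter_upwards [eventually_ge_atTop 1, eventually_ge_atTop (Fintype.card V)] with n hn hV
    exact abs_tieProb_sub_le (hf n hn) hβ hn hV
  simpa using h2.add h1

/-- This is where `Var(Y) = o(1 / log n)` enters: an error in a base raised to a power of order `log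
n` must be `o(1 / log n)`. -/
theorem tendsto_tieProb_fst_sub_mul_log {f : ℕ → ℕ → ℝ} (hf : ∀ n, 1 ≤ n → IsLaw n (f n))
    (hvar : (fun n => pileVariance n (f n)) =o[atTop] (fun n : ℕ => 1 / Real.log (n : ℝ)))
    (r : ℕ) :
    Tendsto (fun n : ℕ => (tieProb n (f n) (Prod.fst : Fin r × Bool → Fin r) -
      qTwo n (f n) ^ r) * Real.log n) atTop (𝓝 0) := by
  have h1 : Tendsto (fun n : ℕ => 1 / (n : ℝ) * Real.log n) atTop (𝓝 0) := by
    have := (Real.isLittleO_log_id_atTop.tendsto_div_nhds_zero).comp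
      (tendsto_natCast_atTop_atTop (R := ℝ))
    refine this.congr fun n => ?_
    simp [div_eq_inv_mul]
  have h2 : Tendsto (fun n : ℕ => pileVariance n (f n) * Real.log n) atTop (𝓝 0) := by
    refine hvar.tendsto_div_nhds_zero.congr fun n => ?_
    rw [div_div_eq_mul_div, div_one]
  have h3 := (h1.const_mul (4 * (r : ℝ) ^ 2 + r)).add (h2.const_mul (4 * (r : ℝ) ^ 2 + 8 * r))
  rw [mul_zero, mul_zero, add_zero] at h3
  refine squeeze_zero_norm' ?_ h3
  filter_upwards [eventually_ge_atTop 2, eventually_ge_atTop (2 * r)] with n hn hr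
  have h4 := abs_tieProb_fst_sub_qTwo_pow_le (hf n (by omega)) r hn hr
  have h5 : 0 ≤ Real.log n := Real.log_natCast_nonneg n
  rw [Real.norm_eq_abs, abs_mul, abs_of_nonneg h5]
  refine (mul_le_mul_of_nonneg_right h4 h5).trans (le_of_eq (by ring))

/-! ### Large blocks are less likely than pairs -/

theorem agree_pos (y : ℝ) : 0 < agree y := by
  unfold agree; nlinarith [sq_nonneg (2 * y - 1)]

theorem agree_lt_one {y : ℝ} (hy : y ∈ Set.Ioo (0 : ℝ) 1) : agree y < 1 := by
  unfold agree; nlinarith [hy.1, hy.2]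

/-- With `m = max y (1 - y)`, raising the exponent by one multiplies the power sum by at most `m`,
and `m ^ 2 < agree y`. -/
theorem sq_pow_add_pow_succ_lt {y : ℝ} (hy : y ∈ Set.Ioo (0 : ℝ) 1) {s : ℕ}
    (h : (y ^ s + (1 - y) ^ s) ^ 2 ≤ agree y ^ s) :
    (y ^ (s + 1) + (1 - y) ^ (s + 1)) ^ 2 < agree y ^ (s + 1) := by
  obtain ⟨h0, h1⟩ := hy
  have h1' : 0 < 1 - y := by linarith
  set m := max y (1 - y)
  have hm : m ^ 2 < agree y := by
    unfold agree
    rcases max_choice y (1 - y) with h | h <;> simp only [m, h] <;> nlinarith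
  have hm0 : 0 ≤ m := h0.le.trans (le_max_left _ _)
  have h2 : y ^ (s + 1) + (1 - y) ^ (s + 1) ≤ m * (y ^ s + (1 - y) ^ s) := by
    have a1 : y * y ^ s ≤ m * y ^ s := mul_le_mul_of_nonneg_right (le_max_left _ _) (by positivity)
    have a2 : (1 - y) * (1 - y) ^ s ≤ m * (1 - y) ^ s :=
      mul_le_mul_of_nonneg_right (le_max_right _ _) (by positivity)
    rw [pow_succ', pow_succ']
    linarith
  have hpos := pow_pos (agree_pos y) s
  calc (y ^ (s + 1) + (1 - y) ^ (s + 1)) ^ 2 ≤ (m * (y ^ s + (1 - y) ^ s)) ^ 2 := by gcongr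
    _ = m ^ 2 * (y ^ s + (1 - y) ^ s) ^ 2 := by ring
    _ ≤ m ^ 2 * agree y ^ s := by gcongr
    _ < agree y * agree y ^ s := by gcongr
    _ = agree y ^ (s + 1) := by ring

theorem sq_pow_add_pow_le {y : ℝ} (hy : y ∈ Set.Ioo (0 : ℝ) 1) {s : ℕ} (hs : 2 ≤ s) :
    (y ^ s + (1 - y) ^ s) ^ 2 ≤ agree y ^ s := by
  induction s, hs using Nat.le_induction with
  | base => exact le_rfl
  | succ s _ ih => exact (sq_pow_add_pow_succ_lt hy ih).le

theorem sq_pow_add_pow_lt {y : ℝ} (hy : y ∈ Set.Ioo (0 : ℝ) 1) {s : ℕ} (hs : 3 ≤ s) :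
    (y ^ s + (1 - y) ^ s) ^ 2 < agree y ^ s := by
  obtain ⟨s, rfl⟩ : ∃ s', s = s' + 1 := ⟨s - 1, by omega⟩
  exact sq_pow_add_pow_succ_lt hy (sq_pow_add_pow_le hy (by omega))

/-- Each block of size `s` costs at most `agree y ^ (s / 2)`, strictly less when `s ≥ 3`;
multiplying over blocks gives the exponent `|V|`. -/
theorem sq_blockPoly_lt {V B : Type*} [Fintype V] [Fintype B] [DecidableEq B] {β : V → B}
    (h2 : ∀ b, 2 ≤ (Finset.univ.filter fun x => β x = b).card)
    (h3 : ∃ b, 3 ≤ (Finset.univ.filter fun x => β x = b).card) {y : ℝ}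
    (hy : y ∈ Set.Ioo (0 : ℝ) 1) :
    blockPoly β y ^ 2 < agree y ^ Fintype.card V := by
  have hc : agree y ^ Fintype.card V = ∏ b, agree y ^ (Finset.univ.filter fun x => β x = b).card := by
    rw [Finset.prod_pow_eq_pow_sum, ← Finset.card_univ,
      Finset.card_eq_sum_card_fiberwise (f := β) (t := Finset.univ) (by simp)]
  rw [hc, blockPoly, ← Finset.prod_pow]
  obtain ⟨b, hb⟩ := h3
  have h1 : 0 < 1 - y := by linarith [hy.2]
  have h0 := hy.1
  exact Finset.prod_lt_prod (fun b _ => by positivity) (fun b _ => sq_pow_add_pow_le hy (h2 b))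
    ⟨b, Finset.mem_univ b, sq_pow_add_pow_lt hy hb⟩

/-! ### Asymptotics at the cutoff time -/

section Cutoff

variable {q : ℕ → ℝ} {G : ℝ} {c : ℝ} {t : ℕ → ℕ} {e : ℕ → ℝ}

theorem tendsto_time_div_log (hq : Tendsto q atTop (𝓝 G)) (hG0 : 0 < G) (hG1 : G < 1)
    (he : Tendsto e atTop (𝓝 0))
    (ht : ∀ᶠ n : ℕ in atTop, (t n : ℝ) = (2 * Real.log n + c + e n) / (-Real.log (q n))) :
    Tendsto (fun n : ℕ => (t n : ℝ) / Real.log n) atTop (𝓝 (2 / (-Real.log G))) := by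
  have hlog : Tendsto (fun n : ℕ => Real.log n) atTop atTop :=
    Real.tendsto_log_atTop.comp tendsto_natCast_atTop_atTop
  have h1 : Tendsto (fun n : ℕ => 2 + (c + e n) / Real.log n) atTop (𝓝 (2 + 0)) :=
    tendsto_const_nhds.add ((he.const_add c).div_atTop hlog)
  have h2 : Tendsto (fun n => -Real.log (q n)) atTop (𝓝 (-Real.log G)) :=
    (hq.log hG0.ne').neg
  have h3 : -Real.log G ≠ 0 := by linarith [Real.log_neg hG0 hG1]
  have h4 := h1.div h2 h3
  rw [add_zero] at h4
  refine h4.congr' ?_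
  filter_upwards [ht, hlog.eventually_gt_atTop 0] with n hn hl
  rw [Pi.div_apply, hn]
  field_simp
  ring

theorem tendsto_time_atTop (hq : Tendsto q atTop (𝓝 G)) (hG0 : 0 < G) (hG1 : G < 1)
    (he : Tendsto e atTop (𝓝 0))
    (ht : ∀ᶠ n : ℕ in atTop, (t n : ℝ) = (2 * Real.log n + c + e n) / (-Real.log (q n))) :
    Tendsto t atTop atTop := by
  have hlog : Tendsto (fun n : ℕ => Real.log n) atTop atTop :=
    Real.tendsto_log_atTop.comp tendsto_natCast_atTop_atTop
  have h1 := tendsto_time_div_log hq hG0 hG1 he ht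
  have h2 : 0 < 2 / (-Real.log G) := by
    have := Real.log_neg hG0 hG1
    exact div_pos two_pos (by linarith)
  rw [← tendsto_natCast_atTop_iff (R := ℝ)]
  refine (h1.pos_mul_atTop h2 hlog).congr' ?_
  filter_upwards [hlog.eventually_gt_atTop 0] with n hl
  field_simp

theorem tendsto_sq_mul_pow_time (hq : Tendsto q atTop (𝓝 G)) (hG0 : 0 < G) (hG1 : G < 1)
    (he : Tendsto e atTop (𝓝 0))
    (ht : ∀ᶠ n : ℕ in atTop, (t n : ℝ) = (2 * Real.log n + c + e n) / (-Real.log (q n))) :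
    Tendsto (fun n : ℕ => (n : ℝ) ^ 2 * q n ^ t n) atTop (𝓝 (Real.exp (-c))) := by
  have h1 : Tendsto (fun n => Real.exp (-(c + e n))) atTop (𝓝 (Real.exp (-(c + 0)))) :=
    (Real.continuous_exp.tendsto _).comp (he.const_add c).neg
  rw [add_zero] at h1
  refine h1.congr' ?_
  filter_upwards [ht, hq.eventually_const_lt hG0, hq.eventually_lt_const hG1,
    eventually_gt_atTop 0] with n hn h0 h1 hpos
  have hl : Real.log (q n) ≠ 0 := (Real.log_neg h0 h1).ne
  have hn' : (0 : ℝ) < n := by exact_mod_cast hpos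
  have h2 : (t n : ℝ) * Real.log (q n) = -(2 * Real.log n + c + e n) := by
    rw [hn]; field_simp
  have h3 : q n ^ t n = Real.exp (-(2 * Real.log n + c + e n)) := by
    rw [← h2, ← Real.log_pow, Real.exp_log (by positivity)]
  have h4 : (n : ℝ) ^ 2 = Real.exp (2 * Real.log n) := by
    rw [mul_comm, Real.exp_mul, Real.exp_log hn']
    norm_cast
  rw [h3, h4, ← Real.exp_add]
  congr 1
  ring

/-- Squeezed between Bernoulli's `1 + t x` and `exp (t x)`. -/
theorem tendsto_one_add_pow {x : ℕ → ℝ} {t : ℕ → ℕ} (hx : ∀ᶠ n in atTop, -1 ≤ x n)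
    (h : Tendsto (fun n => (t n : ℝ) * x n) atTop (𝓝 0)) :
    Tendsto (fun n => (1 + x n) ^ t n) atTop (𝓝 1) := by
  have h1 : Tendsto (fun n => 1 + (t n : ℝ) * x n) atTop (𝓝 1) := by
    simpa using h.const_add 1
  have h2 : Tendsto (fun n => Real.exp ((t n : ℝ) * x n)) atTop (𝓝 1) := by
    rw [← Real.exp_zero]
    exact (Real.continuous_exp.tendsto _).comp h
  refine tendsto_of_tendsto_of_tendsto_of_le_of_le' h1 h2 ?_ ?_
  · filter_upwards [hx] with n hn
    exact one_add_mul_le_pow (by linarith) _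
  · filter_upwards [hx] with n hn
    rw [Real.exp_nat_mul]
    refine pow_le_pow_left₀ (by linarith) ?_ _
    linarith [Real.add_one_le_exp (x n)]

/-- Write `p = q^r (1 + x)`. Since `t` is of order `log n`, `t x → 0`, so `p^t` may be replaced by
`q^(r t)`. -/
theorem tendsto_pow_mul_pow_time (hq : Tendsto q atTop (𝓝 G)) (hG0 : 0 < G) (hG1 : G < 1)
    (he : Tendsto e atTop (𝓝 0))
    (ht : ∀ᶠ n : ℕ in atTop, (t n : ℝ) = (2 * Real.log n + c + e n) / (-Real.log (q n)))
    (r : ℕ) {p : ℕ → ℝ} (hp0 : ∀ᶠ n in atTop, 0 ≤ p n)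
    (hp : Tendsto (fun n : ℕ => (p n - q n ^ r) * Real.log n) atTop (𝓝 0)) :
    Tendsto (fun n : ℕ => (n : ℝ) ^ (2 * r) * p n ^ t n) atTop (𝓝 (Real.exp (-c) ^ r)) := by
  have hlog : Tendsto (fun n : ℕ => Real.log n) atTop atTop :=
    Real.tendsto_log_atTop.comp tendsto_natCast_atTop_atTop
  have h1 := (tendsto_sq_mul_pow_time hq hG0 hG1 he ht).pow r
  have h2 : Tendsto (fun n => (1 + (p n - q n ^ r) / q n ^ r) ^ t n) atTop (𝓝 1) := by
    refine tendsto_one_add_pow ?_ ?_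
    · filter_upwards [hp0, hq.eventually_const_lt hG0] with n hn hqn
      rw [le_div_iff₀ (by positivity)]
      linarith
    · have h3 := ((tendsto_time_div_log hq hG0 hG1 he ht).mul hp).div (hq.pow r)
        (pow_pos hG0 r).ne'
      rw [mul_zero, zero_div] at h3
      refine h3.congr' ?_
      filter_upwards [hlog.eventually_gt_atTop 0] with n hn
      simp only [Pi.div_apply]
      field_simp
  have h3 := h1.mul h2
  rw [mul_one] at h3
  refine h3.congr' ?_
  filter_upwards [hq.eventually_const_lt hG0] with n hqn
  have : 1 + (p n - q n ^ r) / q n ^ r = p n / q n ^ r := by field_simp; ring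
  rw [this, div_pow, mul_pow, ← pow_mul, ← pow_mul, ← pow_mul, mul_comm (t n) r]
  field_simp

/-- The square equals `(n² q^t)^v (p² / q^v)^t`: a convergent factor times one eventually bounded by
`ρ^t` with `ρ < 1`. Squaring avoids half-integer powers when `v` is odd. -/
theorem tendsto_pow_mul_pow_time_zero (hq : Tendsto q atTop (𝓝 G)) (hG0 : 0 < G) (hG1 : G < 1)
    (he : Tendsto e atTop (𝓝 0))
    (ht : ∀ᶠ n : ℕ in atTop, (t n : ℝ) = (2 * Real.log n + c + e n) / (-Real.log (q n)))
    (v : ℕ) {p : ℕ → ℝ} {P : ℝ} (hp0 : ∀ᶠ n in atTop, 0 ≤ p n) (hp : Tendsto p atTop (𝓝 P))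
    (hP : P ^ 2 < G ^ v) :
    Tendsto (fun n : ℕ => (n : ℝ) ^ v * p n ^ t n) atTop (𝓝 0) := by
  have h1 : Tendsto (fun n => p n ^ 2 / q n ^ v) atTop (𝓝 (P ^ 2 / G ^ v)) :=
    (hp.pow 2).div (hq.pow v) (pow_pos hG0 v).ne'
  have h2 : P ^ 2 / G ^ v < 1 := (div_lt_one (pow_pos hG0 v)).2 hP
  obtain ⟨ρ, hρ, hρ1⟩ := exists_between h2
  have hρ0 : 0 ≤ ρ := le_trans (by positivity) hρ.le
  have h3 : Tendsto (fun n => ρ ^ t n) atTop (𝓝 0) :=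
    (tendsto_pow_atTop_nhds_zero_of_lt_one hρ0 hρ1).comp (tendsto_time_atTop hq hG0 hG1 he ht)
  have h4 := ((tendsto_sq_mul_pow_time hq hG0 hG1 he ht).pow v).mul h3
  rw [mul_zero] at h4
  have h5 : Tendsto (fun n : ℕ => ((n : ℝ) ^ v * p n ^ t n) ^ 2) atTop (𝓝 0) := by
    refine squeeze_zero' (Eventually.of_forall fun n => sq_nonneg _) ?_ h4
    filter_upwards [h1.eventually_lt_const hρ, hq.eventually_const_lt hG0] with n hn hqn
    have h6 : p n ^ 2 ≤ ρ * q n ^ v := ((div_lt_iff₀ (pow_pos hqn v)).1 hn).le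
    calc ((n : ℝ) ^ v * p n ^ t n) ^ 2 = (n : ℝ) ^ (2 * v) * (p n ^ 2) ^ t n := by ring
      _ ≤ (n : ℝ) ^ (2 * v) * (ρ * q n ^ v) ^ t n := by gcongr
      _ = ((n : ℝ) ^ 2 * q n ^ t n) ^ v * ρ ^ t n := by ring
  have h6 := h5.sqrt
  rw [Real.sqrt_zero] at h6
  refine h6.congr' ?_
  filter_upwards [hp0] with n hn
  exact Real.sqrt_sq (by positivity)

end Cutoff

/-! ### Bonferroni inequalities and the Poisson limit -/

section Bonferroni

/-- For `m > 0` the truncated alternating sum is `(-1)^(2R) C(m-1, 2R)`, whose sign is that of its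
last term. -/
theorem ite_le_alternating_sum_choose (m R : ℕ) :
    (if m = 0 then (1 : ℝ) else 0) ≤ ∑ i ∈ Finset.range (2 * R + 1), (-1) ^ i * (m.choose i : ℝ) := by
  rcases Nat.eq_zero_or_pos m with rfl | hm
  · rw [Finset.sum_eq_single 0] <;> simp
    intro b _ hb
    exact Nat.choose_eq_zero_of_lt (Nat.pos_of_ne_zero hb)
  · obtain ⟨m, rfl⟩ : ∃ k, m = k + 1 := ⟨m - 1, by omega⟩
    have h := Int.alternating_sum_range_choose_eq_choose (n := m) (m := 2 * R)
    have h' : ∑ i ∈ Finset.range (2 * R + 1), (-1) ^ i * ((m + 1).choose i : ℝ) =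
        (-1) ^ (2 * R) * (m.choose (2 * R) : ℝ) := by exact_mod_cast h
    rw [h']
    simp

theorem alternating_sum_choose_le_ite (m R : ℕ) :
    ∑ i ∈ Finset.range (2 * R + 2), (-1) ^ i * (m.choose i : ℝ) ≤ if m = 0 then (1 : ℝ) else 0 := by
  rcases Nat.eq_zero_or_pos m with rfl | hm
  · rw [Finset.sum_eq_single 0] <;> simp
    intro b _ hb
    exact Nat.choose_eq_zero_of_lt (Nat.pos_of_ne_zero hb)
  · obtain ⟨m, rfl⟩ : ∃ k, m = k + 1 := ⟨m - 1, by omega⟩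
    have h := Int.alternating_sum_range_choose_eq_choose (n := m) (m := 2 * R + 1)
    have h' : ∑ i ∈ Finset.range (2 * R + 2), (-1) ^ i * ((m + 1).choose i : ℝ) =
        (-1) ^ (2 * R + 1) * (m.choose (2 * R + 1) : ℝ) := by exact_mod_cast h
    rw [h']
    simp [pow_succ]

/-- The truncation level is fixed while `n → ∞`; only afterwards does it grow, so no uniformity in
`i` is needed. -/
theorem tendsto_of_bonferroni {x : ℕ → ℝ} {a : ℕ → ℕ → ℝ} {l : ℝ}
    (hu : ∀ᶠ n in atTop, ∀ R, x n ≤ ∑ i ∈ Finset.range (2 * R + 1), (-1) ^ i * a i n)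
    (hl : ∀ᶠ n in atTop, ∀ R, ∑ i ∈ Finset.range (2 * R + 2), (-1) ^ i * a i n ≤ x n)
    (ha : ∀ i, Tendsto (a i) atTop (𝓝 (l ^ i / i.factorial))) :
    Tendsto x atTop (𝓝 (Real.exp (-l))) := by
  have hS : ∀ N, Tendsto (fun n => ∑ i ∈ Finset.range N, (-1) ^ i * a i n) atTop
      (𝓝 (∑ i ∈ Finset.range N, (-l) ^ i / i.factorial)) := by
    intro N
    refine tendsto_finsetSum _ fun i _ => ?_
    have := (ha i).const_mul ((-1) ^ i)
    rwa [← mul_div_assoc, ← mul_pow, neg_one_mul] at this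
  have hE : Tendsto (fun N => ∑ i ∈ Finset.range N, (-l) ^ i / (i.factorial : ℝ)) atTop
      (𝓝 (Real.exp (-l))) := by
    rw [Real.exp_eq_exp_ℝ]
    exact (NormedSpace.expSeries_div_hasSum_exp (-l)).tendsto_sum_nat
  refine tendsto_order.2 ⟨fun y hy => ?_, fun y hy => ?_⟩
  · obtain ⟨N, hN⟩ := eventually_atTop.1 (hE.eventually_const_lt hy)
    filter_upwards [hl, (hS (2 * N + 2)).eventually_const_lt (hN (2 * N + 2) (by omega))]
      with n h1 h2
    exact h2.trans_le (h1 N)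
  · obtain ⟨N, hN⟩ := eventually_atTop.1 (hE.eventually_lt_const hy)
    filter_upwards [hu, (hS (2 * N + 1)).eventually_lt_const (hN (2 * N + 1) (by omega))]
      with n h1 h2
    exact (h1 N).trans_lt h2

end Bonferroni

/-! ### Two-element classes of an equivalence relation -/

section IsolatedPairs

variable {α : Type*} {R : α → α → Prop}

/-- `a` and `b` are distinct and form a class of the relation `R`. -/
def IsolatedPair (R : α → α → Prop) (a b : α) : Prop :=
  a ≠ b ∧ R a b ∧ ∀ k, R a k → k = a ∨ k = b

theorem IsolatedPair.symm (hR : Equivalence R) {a b : α} (h : IsolatedPair R a b) :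
    IsolatedPair R b a :=
  ⟨h.1.symm, hR.symm h.2.1, fun k hk => (h.2.2 k (hR.trans h.2.1 hk)).symm⟩

/-- The number of two-element classes of the relation `R`. -/
noncomputable def isolatedCount [LinearOrder α] [Fintype α] (R : α → α → Prop) : ℕ :=
  Nat.card {p : α × α // p.1 < p.2 ∧ IsolatedPair R p.1 p.2}

/-- Such an embedding is an ordered choice of `r` distinct two-element classes together with an
orientation of each, which gives the factor `2 ^ r`. -/
theorem card_isolated_embeddings [LinearOrder α] [Fintype α] (hR : Equivalence R) (r : ℕ) :
    Nat.card {j : Fin r × Bool ↪ α // ∀ i, IsolatedPair R (j (i, false)) (j (i, true))} =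
      2 ^ r * (isolatedCount R).descFactorial r := by
  classical
  set S := {p : α × α // p.1 < p.2 ∧ IsolatedPair R p.1 p.2}
  have hcard : Nat.card ((Fin r ↪ S) × (Fin r → Bool)) =
      2 ^ r * (isolatedCount R).descFactorial r := by
    rw [Nat.card_prod, Nat.card_eq_fintype_card, Nat.card_eq_fintype_card, Fintype.card_embedding_eq,
      isolatedCount, Nat.card_eq_fintype_card]
    simp [mul_comm, S]
  rw [← hcard]
  symm
  -- the card in position `b` of the `i`-th pair, with the pairs ordered according to `ε`
  let Φ : (Fin r ↪ S) × (Fin r → Bool) → Fin r × Bool → α := fun z x =>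
    if z.2 x.1 = x.2 then (z.1 x.1).1.1 else (z.1 x.1).1.2
  have hΦf : ∀ z i, (Φ z (i, false) = (z.1 i).1.1 ∧ Φ z (i, true) = (z.1 i).1.2 ∧ z.2 i = false) ∨
      (Φ z (i, false) = (z.1 i).1.2 ∧ Φ z (i, true) = (z.1 i).1.1 ∧ z.2 i = true) := by
    intro z i
    cases h : z.2 i <;> simp [Φ, h]
  -- Distinct classes are disjoint; this makes the `2 r` chosen elements distinct.
  have hshare : ∀ p p' : S, (p.1.1 = p'.1.1 ∨ p.1.1 = p'.1.2 ∨ p.1.2 = p'.1.1 ∨ p.1.2 = p'.1.2) →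
      p = p' := by
    rintro ⟨⟨a, b⟩, hab, h⟩ ⟨⟨a', b'⟩, hab', h'⟩ hs
    simp only at hs hab hab' h h'
    have h1 := h.2.2 a'
    have h2 := h.2.2 b'
    have h3 := (h'.symm hR).2.2 a
    have hab2 := h.2.1
    have hab3 := h'.2.1
    have key : a = a' ∧ b = b' := by
      rcases hs with rfl | rfl | rfl | rfl
      · rcases h2 hab3 with rfl | rfl
        · exact absurd hab' (lt_irrefl _)
        · exact ⟨rfl, rfl⟩
      · rcases h1 (hR.symm hab3) with rfl | rfl
        · exact absurd hab' (lt_irrefl _)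
        · exact absurd hab hab'.asymm
      · rcases h2 (hR.trans hab2 hab3) with rfl | rfl
        · exact absurd hab hab'.asymm
        · exact absurd hab' (lt_irrefl _)
      · rcases h1 (hR.trans hab2 (hR.symm hab3)) with rfl | rfl
        · exact ⟨rfl, rfl⟩
        · exact absurd hab' (lt_irrefl _)
    exact Subtype.ext (Prod.ext key.1 key.2)
  have hinj : ∀ z, Function.Injective (Φ z) := by
    rintro z ⟨i, b⟩ ⟨i', b'⟩ h
    have hi : i = i' := by
      refine z.1.injective (hshare _ _ ?_)
      rcases hΦf z i with ⟨h1, h2, _⟩ | ⟨h1, h2, _⟩ <;>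
        rcases hΦf z i' with ⟨h3, h4, _⟩ | ⟨h3, h4, _⟩ <;> cases b <;> cases b' <;> grind
    subst hi
    have hne := (z.1 i).2.1.ne
    rcases hΦf z i with ⟨h1, h2, _⟩ | ⟨h1, h2, _⟩ <;> cases b <;> cases b' <;> grind
  refine Nat.card_congr (Equiv.ofBijective (fun z => ⟨⟨Φ z, hinj z⟩, fun i => ?_⟩) ⟨?_, ?_⟩)
  · have := (z.1 i).2.2
    rcases hΦf z i with ⟨h1, h2, _⟩ | ⟨h1, h2, _⟩ <;> simp only [Function.Embedding.coeFn_mk, h1, h2]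
    exacts [this, this.symm hR]
  · rintro z z' h
    have hz : Φ z = Φ z' := by simpa using h
    have key : ∀ i, z.1 i = z'.1 i ∧ z.2 i = z'.2 i := by
      intro i
      have e1 := congrFun hz (i, false)
      have e2 := congrFun hz (i, true)
      have l1 := (z.1 i).2.1
      have l2 := (z'.1 i).2.1
      rcases hΦf z i with ⟨h1, h2, h3⟩ | ⟨h1, h2, h3⟩ <;>
        rcases hΦf z' i with ⟨h4, h5, h6⟩ | ⟨h4, h5, h6⟩
      · exact ⟨hshare _ _ (Or.inl (by rw [← h1, ← h4, e1])), h3.trans h6.symm⟩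
      · rw [h1, h4] at e1; rw [h2, h5] at e2; rw [e1, e2] at l1; exact absurd l1 l2.asymm
      · rw [h1, h4] at e1; rw [h2, h5] at e2; rw [e1, e2] at l1; exact absurd l1 l2.asymm
      · exact ⟨hshare _ _ (Or.inl (by rw [← h2, ← h5, e2])), h3.trans h6.symm⟩
    refine Prod.ext (DFunLike.ext _ _ fun i => (key i).1) (funext fun i => (key i).2)
  · rintro ⟨j, hj⟩
    have hex : ∀ i, ∃ p : S × Bool, (if p.2 = false then p.1.1.1 else p.1.1.2) = j (i, false) ∧
        (if p.2 = true then p.1.1.1 else p.1.1.2) = j (i, true) := by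
      intro i
      rcases (hj i).1.lt_or_gt with h | h
      · exact ⟨(⟨(_, _), h, hj i⟩, false), by simp, by simp⟩
      · exact ⟨(⟨(_, _), h, (hj i).symm hR⟩, true), by simp, by simp⟩
    choose p hp1 hp2 using hex
    have hpinj : Function.Injective fun i => (p i).1 := by
      intro i i' h
      have a1 := hp1 i; have a2 := hp1 i'; have a3 := hp2 i'
      simp only at h
      rw [h] at a1
      by_contra hne
      have n1 : j (i, false) ≠ j (i', false) := fun h => hne (congrArg Prod.fst (j.injective h))
      have n2 : j (i, false) ≠ j (i', true) := fun h => hne (congrArg Prod.fst (j.injective h))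
      cases hb : (p i).2 <;> cases hb' : (p i').2 <;> simp [hb, hb'] at a1 a2 a3 <;> grind
    refine ⟨(⟨fun i => (p i).1, hpinj⟩, fun i => (p i).2), ?_⟩
    ext ⟨i, b⟩
    cases b
    · exact hp1 i
    · exact hp2 i

/-- A nontrivial class that is not a pair has at least three elements. -/
theorem exists_triple_of_isolatedCount_eq_zero [LinearOrder α] [Fintype α] (hR : Equivalence R)
    (h0 : isolatedCount R = 0) (hne : ¬ ∀ a b, R a b → a = b) :
    ∃ j : Fin 3 ↪ α, ∀ x y, R (j x) (j y) := by
  push Not at hne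
  obtain ⟨a, b, hab, hne⟩ := hne
  have hiso : ¬ IsolatedPair R a b := by
    intro h
    have hemp : IsEmpty {p : α × α // p.1 < p.2 ∧ IsolatedPair R p.1 p.2} := by
      rw [isolatedCount, Nat.card_eq_zero] at h0
      exact h0.resolve_right fun h => h.not_finite inferInstance
    rcases hne.lt_or_gt with hl | hl
    · exact hemp.false ⟨(a, b), hl, h⟩
    · exact hemp.false ⟨(b, a), hl, h.symm hR⟩
  unfold IsolatedPair at hiso
  push Not at hiso
  obtain ⟨k, hak, hka, hkb⟩ := hiso hne hab
  have hv : ∀ x : Fin 3, R a (![a, b, k] x) := by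
    intro x; fin_cases x
    exacts [hR.refl a, hab, hak]
  refine ⟨⟨![a, b, k], ?_⟩, fun x y => hR.trans (hR.symm (hv x)) (hv y)⟩
  intro x y hxy
  fin_cases x <;> fin_cases y <;> simp_all [eq_comm]

end IsolatedPairs

/-! ### Binomial moments of the number of isolated pairs -/

section Moments

variable {n : ℕ} {f : ℕ → ℝ} {t : ℕ}

theorem equivalence_tied (A : Fin t → Finset (Fin n)) : Equivalence (Tied A) :=
  ⟨Tied.refl A, Tied.symm, Tied.trans⟩

/-- The expected number of `r`-element sets of isolated tied pairs of cards. -/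
noncomputable def isolatedMoment (n : ℕ) (f : ℕ → ℝ) (t r : ℕ) : ℝ :=
  ∑ A : Fin t → Finset (Fin n), (∏ s, weight n f (A s)) * ((isolatedCount (Tied A)).choose r : ℝ)

/-- The `i`-th pair of cards is an isolated tied pair, for every `i`. -/
def PairsIsolated {r : ℕ} (j : Fin r × Bool → Fin n) (A : Fin t → Finset (Fin n)) : Prop :=
  ∀ i, IsolatedPair (Tied A) (j (i, false)) (j (i, true))

theorem mul_isolatedMoment (n : ℕ) (f : ℕ → ℝ) (t r : ℕ) :
    2 ^ r * (r.factorial : ℝ) * isolatedMoment n f t r =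
      ∑ j : Fin r × Bool ↪ Fin n, pathProb n f t (PairsIsolated j) := by
  classical
  simp only [pathProb_eq_sum]
  rw [Finset.sum_comm, isolatedMoment, Finset.mul_sum]
  refine Finset.sum_congr rfl fun A _ => ?_
  have h : Nat.card {j : Fin r × Bool ↪ Fin n // PairsIsolated j A} =
      2 ^ r * (isolatedCount (Tied A)).descFactorial r :=
    card_isolated_embeddings (equivalence_tied A) r
  rw [Nat.descFactorial_eq_factorial_mul_choose, Nat.card_eq_fintype_card,
    Fintype.card_subtype] at h
  have h' : (2 : ℝ) ^ r * (r.factorial * (isolatedCount (Tied A)).choose r) =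
      ((Finset.univ.filter fun j : Fin r × Bool ↪ Fin n => PairsIsolated j A).card : ℝ) := by
    exact_mod_cast h.symm
  rw [← Finset.sum_filter, Finset.sum_const, nsmul_eq_mul, ← h']
  ring

/-- A card is added to the `i`-th pair. -/
def tripleBlock {r : ℕ} (i : Fin r) : Option (Fin r × Bool) → Fin r := fun x => x.elim i Prod.fst

/-- The index of the pair containing `x`, after the `i'`-th pair is merged into the `i`-th one. -/
def mergeIndex {r : ℕ} (i i' : Fin r) (x : Fin r × Bool) : Fin r := if x.1 = i' then i else x.1

/-- The `i'`-th pair is merged into the `i`-th one. -/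
def mergeBlock {r : ℕ} (i i' : Fin r) : Fin r × Bool → Set.range (mergeIndex i i') :=
  Set.rangeFactorization (mergeIndex i i')

theorem mergeBlock_eq_iff {r : ℕ} (i i' : Fin r) (x y : Fin r × Bool) :
    mergeBlock i i' x = mergeBlock i i' y ↔ mergeIndex i i' x = mergeIndex i i' y := by
  simp [mergeBlock, Set.rangeFactorization, Subtype.ext_iff]

/-- A pair fails to be isolated because some further card `k` is tied to it. Either `k` is outside
the placed cards, and a block of three appears, or `k` lies in another pair, and two pairs merge. -/
theorem exists_of_tied_of_not_isolated {r : ℕ} {j : Fin r × Bool ↪ Fin n}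
    {A : Fin t → Finset (Fin n)} (h : ∀ x y : Fin r × Bool, x.1 = y.1 → Tied A (j x) (j y))
    (h' : ¬ PairsIsolated j A) :
    (∃ i k, (∀ x, k ≠ j x) ∧ ∀ x y, tripleBlock i x = tripleBlock i y →
      Tied A (x.elim k j) (y.elim k j)) ∨
    ∃ i i', i ≠ i' ∧ ∀ x y, mergeBlock i i' x = mergeBlock i i' y → Tied A (j x) (j y) := by
  unfold PairsIsolated IsolatedPair at h'
  push Not at h'
  obtain ⟨i, hi⟩ := h'
  obtain ⟨k, hk, hkf, hkt⟩ := hi (fun h => by simpa using j.injective h) (h _ _ rfl)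
  by_cases hkr : ∃ x, k = j x
  · obtain ⟨⟨i', b⟩, rfl⟩ := hkr
    refine Or.inr ⟨i, i', ?_, fun x y hxy => ?_⟩
    · rintro rfl
      cases b
      · exact hkf rfl
      · exact hkt rfl
    · rw [mergeBlock_eq_iff] at hxy
      have key : ∀ x, Tied A (j x) (j (mergeIndex i i' x, false)) := by
        intro x
        unfold mergeIndex
        split_ifs with hx
        · exact (h x (i', b) hx).trans hk.symm
        · exact h _ _ rfl
      have := key x
      rw [hxy] at this
      exact this.trans (key y).symm
  · push Not at hkr
    refine Or.inl ⟨i, k, hkr, fun x y hxy => ?_⟩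
    have key : ∀ x, Tied A (x.elim k j) (j (tripleBlock i x, false)) := by
      rintro (_ | x)
      · exact hk.symm
      · exact h _ _ rfl
    have := key x
    rw [hxy] at this
    exact this.trans (key y).symm

theorem pathProb_pairsIsolated_le (hf : IsLaw n f) {r : ℕ} (j : Fin r × Bool ↪ Fin n) :
    pathProb n f t (PairsIsolated j) ≤ tieProb n f (Prod.fst : Fin r × Bool → Fin r) ^ t := by
  rw [← pathProb_tied n f t _ j]
  refine pathProb_mono hf fun A hA => ?_
  rintro ⟨i, b⟩ ⟨i', b'⟩ (rfl : i = i')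
  have h := (hA i).2.1
  cases b <;> cases b'
  exacts [Tied.refl _ _, h, h.symm, Tied.refl _ _]

/-- A union bound over the ways isolation can fail; the factor `n` accounts for the choice of the
extra card. -/
theorem le_pathProb_pairsIsolated (hf : IsLaw n f) {r : ℕ} (j : Fin r × Bool ↪ Fin n) :
    tieProb n f (Prod.fst : Fin r × Bool → Fin r) ^ t -
      (∑ i : Fin r, n * tieProb n f (tripleBlock i) ^ t +
        ∑ z ∈ (Finset.univ : Finset (Fin r)).offDiag, tieProb n f (mergeBlock z.1 z.2) ^ t) ≤
      pathProb n f t (PairsIsolated j) := by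
  rw [← pathProb_tied n f t _ j, ← pathProb_add_compl _ (PairsIsolated j)]
  have h1 : pathProb n f t (fun A => (∀ x y : Fin r × Bool, x.1 = y.1 → Tied A (j x) (j y)) ∧
      PairsIsolated j A) ≤ pathProb n f t (PairsIsolated j) := pathProb_mono hf fun A h => h.2
  let F : (Fin r × Fin n) ⊕ (Fin r × Fin r) → (Fin t → Finset (Fin n)) → Prop :=
    Sum.elim
      (fun z A => (∀ x, z.2 ≠ j x) ∧ ∀ x y, tripleBlock z.1 x = tripleBlock z.1 y →
        Tied A (x.elim z.2 j) (y.elim z.2 j))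
      (fun z A => ∀ x y, mergeBlock z.1 z.2 x = mergeBlock z.1 z.2 y → Tied A (j x) (j y))
  have h2 := pathProb_union_le (t := t) hf
    (Finset.disjSum Finset.univ (Finset.univ : Finset (Fin r)).offDiag)
    (E := fun A => (∀ x y : Fin r × Bool, x.1 = y.1 → Tied A (j x) (j y)) ∧
      ¬ PairsIsolated j A) (F := F) (fun A hA => by
      rcases exists_of_tied_of_not_isolated hA.1 hA.2 with ⟨i, k, hik⟩ | ⟨i, i', hii, h⟩
      · exact ⟨Sum.inl (i, k), by simp, hik⟩
      · exact ⟨Sum.inr (i, i'), by simpa using hii, h⟩)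
  rw [Finset.sum_disjSum] at h2
  have h3 : ∑ z, pathProb n f t (F (Sum.inl z)) ≤
      ∑ i : Fin r, n * tieProb n f (tripleBlock i) ^ t := by
    rw [Fintype.sum_prod_type]
    refine Finset.sum_le_sum fun i _ => ?_
    have h4 : ∀ k, pathProb n f t (F (Sum.inl (i, k))) ≤ tieProb n f (tripleBlock i) ^ t := by
      intro k
      by_cases hk : ∀ x, k ≠ j x
      · let j' : Option (Fin r × Bool) ↪ Fin n :=
          ⟨fun x => x.elim k j, by
            rintro (_ | x) (_ | y) hxy
            · rfl
            · exact absurd hxy (hk y)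
            · exact absurd hxy.symm (hk x)
            · exact congrArg some (j.injective hxy)⟩
        rw [← pathProb_tied n f t (tripleBlock i) j']
        exact pathProb_mono hf fun A hA => hA.2
      -- Here `k` is already placed, so the event is empty.
      · refine le_trans (le_of_eq ?_) (pow_nonneg (tieProb_nonneg hf _) _)
        have : ∀ A, ¬ F (Sum.inl (i, k)) A := fun A hA => hk hA.1
        unfold pathProb
        exact Finset.sum_eq_zero fun A _ => if_neg (this A)
    refine (Finset.sum_le_sum fun k _ => h4 k).trans (le_of_eq ?_)
    simp
  have h5 : ∑ z ∈ (Finset.univ : Finset (Fin r)).offDiag, pathProb n f t (F (Sum.inr z)) =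
      ∑ z ∈ (Finset.univ : Finset (Fin r)).offDiag, tieProb n f (mergeBlock z.1 z.2) ^ t :=
    Finset.sum_congr rfl fun z _ => pathProb_tied n f t (mergeBlock z.1 z.2) j
  linarith

theorem mul_isolatedMoment_le (hf : IsLaw n f) (r : ℕ) :
    2 ^ r * (r.factorial : ℝ) * isolatedMoment n f t r ≤
      (n.descFactorial (2 * r) : ℝ) * tieProb n f (Prod.fst : Fin r × Bool → Fin r) ^ t := by
  rw [mul_isolatedMoment]
  refine (Finset.sum_le_sum fun j _ => pathProb_pairsIsolated_le hf j).trans (le_of_eq ?_)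
  simp [Fintype.card_embedding_eq, mul_comm]

theorem le_mul_isolatedMoment (hf : IsLaw n f) (r : ℕ) :
    (n.descFactorial (2 * r) : ℝ) * tieProb n f (Prod.fst : Fin r × Bool → Fin r) ^ t -
      (∑ i : Fin r, (n : ℝ) ^ (2 * r + 1) * tieProb n f (tripleBlock i) ^ t +
        ∑ z ∈ (Finset.univ : Finset (Fin r)).offDiag,
          (n : ℝ) ^ (2 * r) * tieProb n f (mergeBlock z.1 z.2) ^ t) ≤
      2 ^ r * (r.factorial : ℝ) * isolatedMoment n f t r := by
  rw [mul_isolatedMoment]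
  refine le_trans ?_ (Finset.sum_le_sum fun j _ => le_pathProb_pairsIsolated hf j)
  have hd : (n.descFactorial (2 * r) : ℝ) ≤ (n : ℝ) ^ (2 * r) := by
    exact_mod_cast Nat.descFactorial_le_pow n (2 * r)
  set X := ∑ i : Fin r, (n : ℝ) * tieProb n f (tripleBlock i) ^ t +
    ∑ z ∈ (Finset.univ : Finset (Fin r)).offDiag, tieProb n f (mergeBlock z.1 z.2) ^ t with hX
  have hX0 : 0 ≤ X := add_nonneg
    (Finset.sum_nonneg fun i _ => mul_nonneg (Nat.cast_nonneg n) (pow_nonneg (tieProb_nonneg hf _) _))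
    (Finset.sum_nonneg fun z _ => pow_nonneg (tieProb_nonneg hf _) _)
  have h1 : ∑ i : Fin r, (n : ℝ) ^ (2 * r + 1) * tieProb n f (tripleBlock i) ^ t +
        ∑ z ∈ (Finset.univ : Finset (Fin r)).offDiag,
          (n : ℝ) ^ (2 * r) * tieProb n f (mergeBlock z.1 z.2) ^ t = (n : ℝ) ^ (2 * r) * X := by
    rw [hX, mul_add, Finset.mul_sum, Finset.mul_sum]
    simp only [pow_succ, mul_assoc]
  have h2 : ∑ _j : Fin r × Bool ↪ Fin n,
      (tieProb n f (Prod.fst : Fin r × Bool → Fin r) ^ t - X) =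
      (n.descFactorial (2 * r) : ℝ) *
        (tieProb n f (Prod.fst : Fin r × Bool → Fin r) ^ t - X) := by
    rw [Finset.sum_const, nsmul_eq_mul, Finset.card_univ, Fintype.card_embedding_eq]
    simp [mul_comm]
  rw [h1, h2, mul_sub]
  have := mul_le_mul_of_nonneg_right hd hX0
  linarith

theorem pathProb_isolatedCount_eq_zero (n : ℕ) (f : ℕ → ℝ) (t : ℕ) :
    pathProb n f t (fun A => isolatedCount (Tied A) = 0) =
      ∑ A : Fin t → Finset (Fin n), (∏ s, weight n f (A s)) *
        if isolatedCount (Tied A) = 0 then 1 else 0 := by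
  rw [pathProb_eq_sum]
  simp only [mul_ite, mul_one, mul_zero]

theorem sum_alternating_isolatedMoment (n : ℕ) (f : ℕ → ℝ) (t N : ℕ) :
    ∑ i ∈ Finset.range N, (-1) ^ i * isolatedMoment n f t i =
      ∑ A : Fin t → Finset (Fin n), (∏ s, weight n f (A s)) *
        ∑ i ∈ Finset.range N, (-1) ^ i * ((isolatedCount (Tied A)).choose i : ℝ) := by
  simp only [isolatedMoment, Finset.mul_sum]
  rw [Finset.sum_comm]
  exact Finset.sum_congr rfl fun A _ => Finset.sum_congr rfl fun i _ => by ring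

theorem pathProb_isolatedCount_le (hf : IsLaw n f) (R : ℕ) :
    pathProb n f t (fun A => isolatedCount (Tied A) = 0) ≤
      ∑ i ∈ Finset.range (2 * R + 1), (-1) ^ i * isolatedMoment n f t i := by
  rw [pathProb_isolatedCount_eq_zero, sum_alternating_isolatedMoment]
  exact Finset.sum_le_sum fun A _ =>
    mul_le_mul_of_nonneg_left (ite_le_alternating_sum_choose _ R) (pathWeight_nonneg hf A)

theorem le_pathProb_isolatedCount (hf : IsLaw n f) (R : ℕ) :
    ∑ i ∈ Finset.range (2 * R + 2), (-1) ^ i * isolatedMoment n f t i ≤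
      pathProb n f t (fun A => isolatedCount (Tied A) = 0) := by
  rw [pathProb_isolatedCount_eq_zero, sum_alternating_isolatedMoment]
  exact Finset.sum_le_sum fun A _ =>
    mul_le_mul_of_nonneg_left (alternating_sum_choose_le_ite _ R) (pathWeight_nonneg hf A)

theorem isolatedCount_eq_zero_of_distinguished {A : Fin t → Finset (Fin n)}
    (h : Distinguished A) : isolatedCount (Tied A) = 0 := by
  have : IsEmpty {p : Fin n × Fin n // p.1 < p.2 ∧ IsolatedPair (Tied A) p.1 p.2} :=
    ⟨fun p => p.2.2.1 (h _ _ p.2.2.2.1)⟩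
  exact Nat.card_of_isEmpty

theorem pathProb_distinguished_add (n : ℕ) (f : ℕ → ℝ) (t : ℕ) :
    pathProb n f t Distinguished +
      pathProb n f t (fun A => isolatedCount (Tied A) = 0 ∧ ¬ Distinguished A) =
      pathProb n f t (fun A => isolatedCount (Tied A) = 0) := by
  rw [← pathProb_add_compl (fun A => isolatedCount (Tied A) = 0) Distinguished]
  congr 1
  exact pathProb_congr fun A =>
    ⟨fun h => ⟨isolatedCount_eq_zero_of_distinguished h, h⟩, fun h => h.2⟩

theorem pathProb_not_distinguished_le (hf : IsLaw n f) :
    pathProb n f t (fun A => isolatedCount (Tied A) = 0 ∧ ¬ Distinguished A) ≤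
      (n : ℝ) ^ 3 * tieProb n f (fun _ : Fin 3 => ()) ^ t := by
  have h1 := pathProb_union_le (t := t) hf (Finset.univ : Finset (Fin 3 ↪ Fin n))
    (E := fun A => isolatedCount (Tied A) = 0 ∧ ¬ Distinguished A)
    (F := fun j A => ∀ x y, (fun _ : Fin 3 => ()) x = (fun _ : Fin 3 => ()) y →
      Tied A (j x) (j y)) (fun A hA => by
      obtain ⟨j, hj⟩ := exists_triple_of_isolatedCount_eq_zero (equivalence_tied A) hA.1 hA.2
      exact ⟨j, Finset.mem_univ j, fun x y _ => hj x y⟩)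
  rw [Finset.sum_congr rfl fun j _ => pathProb_tied n f t (fun _ : Fin 3 => ()) j,
    Finset.sum_const, Finset.card_univ, Fintype.card_embedding_eq, Fintype.card_fin,
    Fintype.card_fin, nsmul_eq_mul] at h1
  refine h1.trans (mul_le_mul_of_nonneg_right ?_ (pow_nonneg (tieProb_nonneg hf _) _))
  exact_mod_cast Nat.descFactorial_le_pow n 3

end Moments

/-! ### Passage to the limit -/

section Blocks

theorem surjective_of_two_le_card_fiber {V B : Type*} [Fintype V] [DecidableEq B] {β : V → B}
    (h2 : ∀ b, 2 ≤ (Finset.univ.filter fun x => β x = b).card) : Function.Surjective β := by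
  intro b
  obtain ⟨x, hx⟩ := Finset.card_pos.1 (lt_of_lt_of_le two_pos (h2 b))
  exact ⟨x, (Finset.mem_filter.1 hx).2⟩

theorem two_le_card_fiber {V B : Type*} [Fintype V] [DecidableEq B] {β : V → B} {b : B} {x y : V}
    (hxy : x ≠ y) (hx : β x = b) (hy : β y = b) :
    2 ≤ (Finset.univ.filter fun x => β x = b).card :=
  Finset.one_lt_card.2 ⟨x, by simpa using hx, y, by simpa using hy, hxy⟩

theorem three_le_card_fiber {V B : Type*} [Fintype V] [DecidableEq B] {β : V → B} {b : B}
    {x y z : V} (hxy : x ≠ y) (hxz : x ≠ z) (hyz : y ≠ z) (hx : β x = b) (hy : β y = b)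
    (hz : β z = b) : 3 ≤ (Finset.univ.filter fun x => β x = b).card :=
  Finset.two_lt_card.2 ⟨x, by simpa using hx, y, by simpa using hy, z, by simpa using hz,
    hxy, hxz, hyz⟩

end Blocks

section Limit

variable {f : ℕ → ℕ → ℝ} {α : ℝ} {c : ℝ} {t : ℕ → ℕ} {e : ℕ → ℝ}

theorem tendsto_pow_mul_tieProb_zero (hf : ∀ n, 1 ≤ n → IsLaw n (f n))
    (hα : α ∈ Set.Ioo (0 : ℝ) 1)
    (hprob : ∀ ε : ℝ, 0 < ε → Tendsto (fun n => deviationProb n (f n) α ε) atTop (𝓝 0))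
    (he : Tendsto e atTop (𝓝 0))
    (ht : ∀ᶠ n : ℕ in atTop, (t n : ℝ) =
      (2 * Real.log (n : ℝ) + c + e n) / (-Real.log (qTwo n (f n))))
    {V B : Type*} [Fintype V] [Fintype B] [DecidableEq B] {β : V → B}
    (h2 : ∀ b, 2 ≤ (Finset.univ.filter fun x => β x = b).card)
    (h3 : ∃ b, 3 ≤ (Finset.univ.filter fun x => β x = b).card) :
    Tendsto (fun n : ℕ => (n : ℝ) ^ Fintype.card V * tieProb n (f n) β ^ t n) atTop (𝓝 0) := by
  refine tendsto_pow_mul_pow_time_zero (tendsto_qTwo hf hα hprob) (agree_pos α) (agree_lt_one hα)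
    he ht _ ?_ (tendsto_tieProb hf hα hprob (surjective_of_two_le_card_fiber h2))
    (sq_blockPoly_lt h2 h3 hα)
  filter_upwards [eventually_ge_atTop 1] with n hn
  exact tieProb_nonneg (hf n hn) β

theorem tendsto_isolatedMoment (hf : ∀ n, 1 ≤ n → IsLaw n (f n)) (hα : α ∈ Set.Ioo (0 : ℝ) 1)
    (hprob : ∀ ε : ℝ, 0 < ε → Tendsto (fun n => deviationProb n (f n) α ε) atTop (𝓝 0))
    (hvar : (fun n => pileVariance n (f n)) =o[atTop] (fun n : ℕ => 1 / Real.log (n : ℝ)))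
    (he : Tendsto e atTop (𝓝 0))
    (ht : ∀ᶠ n : ℕ in atTop, (t n : ℝ) =
      (2 * Real.log (n : ℝ) + c + e n) / (-Real.log (qTwo n (f n)))) (r : ℕ) :
    Tendsto (fun n => isolatedMoment n (f n) (t n) r) atTop
      (𝓝 ((1 / 2 * Real.exp (-c)) ^ r / r.factorial)) := by
  have hpair := tendsto_pow_mul_pow_time (tendsto_qTwo hf hα hprob) (agree_pos α)
    (agree_lt_one hα) he ht r
    (by filter_upwards [eventually_ge_atTop 1] with n hn using tieProb_nonneg (hf n hn) _)
    (tendsto_tieProb_fst_sub_mul_log hf hvar r)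
  have hratio : Tendsto (fun n : ℕ => (n.descFactorial (2 * r) : ℝ) / (n : ℝ) ^ (2 * r)) atTop
      (𝓝 1) := by
    have h1 := (tendsto_const_div_atTop_nhds_zero_nat (((2 * r : ℕ) : ℝ) ^ 2)).const_sub 1
    rw [sub_zero] at h1
    refine tendsto_of_tendsto_of_tendsto_of_le_of_le' h1 tendsto_const_nhds ?_ ?_
    · filter_upwards [eventually_ge_atTop 1] with n hn
      linarith [one_sub_descFactorial_div_pow_le hn (2 * r)]
    · filter_upwards with n
      exact div_le_one_of_le₀ (by exact_mod_cast Nat.descFactorial_le_pow n (2 * r)) (by positivity)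
  have hmain : Tendsto (fun n : ℕ => (n.descFactorial (2 * r) : ℝ) *
      tieProb n (f n) (Prod.fst : Fin r × Bool → Fin r) ^ t n) atTop (𝓝 (Real.exp (-c) ^ r)) := by
    have h1 := hratio.mul hpair
    rw [one_mul] at h1
    refine h1.congr' ?_
    filter_upwards [eventually_ge_atTop 1] with n hn
    have : (n : ℝ) ≠ 0 := by positivity
    field_simp
  have htriple : ∀ i : Fin r, Tendsto (fun n : ℕ => (n : ℝ) ^ (2 * r + 1) *
      tieProb n (f n) (tripleBlock i) ^ t n) atTop (𝓝 0) := by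
    intro i
    have := tendsto_pow_mul_tieProb_zero hf hα hprob he ht (β := tripleBlock i)
      (fun b => two_le_card_fiber (x := some (b, false)) (y := some (b, true)) (by simp) rfl rfl)
      ⟨i, three_le_card_fiber (x := none) (y := some (i, false)) (z := some (i, true))
        (by simp) (by simp) (by simp) rfl rfl rfl⟩
    -- `Option (Fin r × Bool)` has `2 r + 1` elements, matching the power of `n`.
    simpa [mul_comm] using this
  have hmerge : ∀ z ∈ (Finset.univ : Finset (Fin r)).offDiag, Tendsto (fun n : ℕ =>
      (n : ℝ) ^ (2 * r) * tieProb n (f n) (mergeBlock z.1 z.2) ^ t n) atTop (𝓝 0) := by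
    rintro ⟨i, i'⟩ hz
    have hne : i ≠ i' := by simpa using hz
    have := tendsto_pow_mul_tieProb_zero hf hα hprob he ht (β := mergeBlock i i')
      (fun b => by
        -- The codomain is the range of `mergeIndex`, so the emptied index `i'` is not a block and
        -- every block contains a full pair.
        obtain ⟨_, ⟨k, b⟩, rfl⟩ := b
        exact two_le_card_fiber (x := (k, false)) (y := (k, true)) (by simp) rfl rfl)
      ⟨mergeBlock i i' (i, false),
        three_le_card_fiber (x := (i, false)) (y := (i, true)) (z := (i', false))
        (by simp) (by simp [hne]) (by simp) rfl rfl
        ((mergeBlock_eq_iff _ _ _ _).2 (by simp [mergeIndex]))⟩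
    simpa [mul_comm] using this
  have herr := (tendsto_finsetSum Finset.univ fun i _ => htriple i).add
    (tendsto_finsetSum (Finset.univ : Finset (Fin r)).offDiag hmerge)
  simp only [Finset.sum_const_zero, add_zero] at herr
  have hlow := hmain.sub herr
  rw [sub_zero] at hlow
  have hmid : Tendsto (fun n => 2 ^ r * (r.factorial : ℝ) * isolatedMoment n (f n) (t n) r) atTop
      (𝓝 (Real.exp (-c) ^ r)) := by
    refine tendsto_of_tendsto_of_tendsto_of_le_of_le' hlow hmain ?_ ?_
    · filter_upwards [eventually_ge_atTop 1] with n hn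
      exact le_mul_isolatedMoment (hf n hn) r
    · filter_upwards [eventually_ge_atTop 1] with n hn
      exact mul_isolatedMoment_le (hf n hn) r
  have h := hmid.div_const (2 ^ r * (r.factorial : ℝ))
  have hl : Real.exp (-c) ^ r / (2 ^ r * (r.factorial : ℝ)) =
      (1 / 2 * Real.exp (-c)) ^ r / r.factorial := by
    rw [mul_pow, div_pow, one_pow]
    field_simp
  rw [hl] at h
  refine h.congr fun n => ?_
  field_simp

theorem tendsto_pathProb_distinguished (hf : ∀ n, 1 ≤ n → IsLaw n (f n))
    (hα : α ∈ Set.Ioo (0 : ℝ) 1)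
    (hprob : ∀ ε : ℝ, 0 < ε → Tendsto (fun n => deviationProb n (f n) α ε) atTop (𝓝 0))
    (hvar : (fun n => pileVariance n (f n)) =o[atTop] (fun n : ℕ => 1 / Real.log (n : ℝ)))
    (he : Tendsto e atTop (𝓝 0))
    (ht : ∀ᶠ n : ℕ in atTop, (t n : ℝ) =
      (2 * Real.log (n : ℝ) + c + e n) / (-Real.log (qTwo n (f n)))) :
    Tendsto (fun n => pathProb n (f n) (t n) Distinguished) atTop
      (𝓝 (Real.exp (-(1 / 2 * Real.exp (-c))))) := by
  have h1 : Tendsto (fun n => pathProb n (f n) (t n) (fun A => isolatedCount (Tied A) = 0)) atTop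
      (𝓝 (Real.exp (-(1 / 2 * Real.exp (-c))))) := by
    refine tendsto_of_bonferroni (a := fun r n => isolatedMoment n (f n) (t n) r) ?_ ?_
      (tendsto_isolatedMoment hf hα hprob hvar he ht)
    · filter_upwards [eventually_ge_atTop 1] with n hn R
      exact pathProb_isolatedCount_le (hf n hn) R
    · filter_upwards [eventually_ge_atTop 1] with n hn R
      exact le_pathProb_isolatedCount (hf n hn) R
  have h2 : Tendsto (fun n : ℕ => (n : ℝ) ^ 3 * tieProb n (f n) (fun _ : Fin 3 => ()) ^ t n) atTop
      (𝓝 0) := by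
    have := tendsto_pow_mul_tieProb_zero hf hα hprob he ht (β := fun _ : Fin 3 => ())
      (fun b => by simp) ⟨(), by simp⟩
    simpa using this
  have h3 : Tendsto (fun n => pathProb n (f n) (t n)
      (fun A => isolatedCount (Tied A) = 0 ∧ ¬ Distinguished A)) atTop (𝓝 0) := by
    refine squeeze_zero' ?_ ?_ h2
    · filter_upwards [eventually_ge_atTop 1] with n hn
      exact pathProb_nonneg (hf n hn) _
    · filter_upwards [eventually_ge_atTop 1] with n hn
      exact pathProb_not_distinguished_le (hf n hn)
  have h4 := h1.sub h3
  rw [sub_zero] at h4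
  refine h4.congr fun n => ?_
  rw [← pathProb_distinguished_add]
  ring

end Limit

end InverseRiffle

theorem mainTheorem1
    (f : ℕ → ℕ → ℝ) (hf : ∀ n, 1 ≤ n → InverseRiffle.IsLaw n (f n))
    (π : (n : ℕ) → Equiv.Perm (Fin n) → ℝ)
    (hπ : ∀ n, 1 ≤ n → MarkovChain.IsStationary (InverseRiffle.transition n (f n)) (π n))
    (α : ℝ) (hα : α ∈ Set.Ioo (0 : ℝ) 1)
    (hprob : ∀ ε : ℝ, 0 < ε →
      Tendsto (fun n => InverseRiffle.deviationProb n (f n) α ε) atTop (𝓝 0))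
    (hvar : (fun n => InverseRiffle.pileVariance n (f n)) =o[atTop]
      (fun n : ℕ => 1 / Real.log (n : ℝ)))
    (c : ℝ) (t : ℕ → ℕ) (e : ℕ → ℝ) (he : Tendsto e atTop (𝓝 0))
    (ht : ∀ᶠ n : ℕ in atTop, (t n : ℝ) =
      (2 * Real.log (n : ℝ) + c + e n) / (-Real.log (InverseRiffle.qTwo n (f n)))) :
    Tendsto
      (fun n => MarkovChain.separation (InverseRiffle.transition n (f n)) (π n) (t n)) atTop
      (𝓝 (1 - Real.exp (-(1 / 2) * Real.exp (-c)))) := by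
  have h := InverseRiffle.tendsto_pathProb_distinguished hf hα hprob hvar he ht
  rw [neg_mul]
  refine (h.const_sub 1).congr' ?_
  -- The limit is positive, so eventually the distinguished probability is too; the exact separation
  -- formula then applies to any stationary `π n`.
  filter_upwards [eventually_ge_atTop 1, h.eventually_const_lt (Real.exp_pos _)] with n hn hD
  exact (InverseRiffle.separation_transition (hf n hn) hD (hπ n hn)).symm
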